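/- Let $k$ be a field of characteristic zero and $S=k[x,y]$. Let $\mathcal A$ be a central arrangement of three distinct lines in $k^2$, with defining polynomial $Q=\ell_1\ell_2\ell_3$, where $\ell_1,\ell_2,\ell_3\in S$ are pairwise linearly independent linear forms. Let $\operatorname{Diff}\mathcal A$ be the algebra of differential operators on $S$ that preserve the ideal $QS$ and all its powers. For an associative algebra $U$ let $\operatorname{Out}(U)$ be the Lie algebra of $k$-linear derivations of $U$ modulo inner derivations, with the bracket induced by the commutator. Sending the class of a $1$-cocycle of the Hochschild cochain complex to the class of the same map as a derivation is an isomorphism of Lie algebras $HH^1(\operatorname{Diff}\mathcal A)\cong\operatorname{Out}(\operatorname{Diff}\mathcal A)$, the bracket on $HH^1$ being the Gerstenhaber bracket. The Lie algebra $\operatorname{Out}(\operatorname{Diff}\mathcal A)$ is abelian of dimension three. Moreover, suppose that $Q=xF$ with $F=y(tx+y)$ and $t\in k$, $t\neq0$, and consider in $U=\operatorname{Diff}\mathcal A$ the elements $x$, $y$, $E=x\partial_x+y\partial_y$ and $D=F\partial_y$. For each $f\in\{x,\ y,\ tx+y\}$ there is exactly one derivation $\partial_f:U\to U$ such that $$\partial_f(x)=\partial_f(y)=0,\qquad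 \partial_f(D)=\frac{F}{f}\,\frac{\partial f}{\partial y},\qquad \partial_f(E)=1,$$ and the classes of $\partial_x$, $\partial_y$ and $\partial_{tx+y}$ form a basis of $\operatorname{Out}(U)$. -/

import Mathlib

attribute [local instance 100] LieRing.ofAssociativeRing

noncomputable section

namespace ThreeLines

/-! ### Derivations, inner derivations and outer derivations of an associative algebra -/

section Out

variable (k : Type*) [CommRing k] (U : Type*) [Ring U] [Algebra k U]

/-- The Lie algebra (under the commutator) of `k`-linear derivations of the associative, not
necessarily commutative, algebra `U`. -/
def Der : LieSubalgebra k (Module.End k U) where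
  carrier := {d | ∀ a b : U, d (a * b) = d a * b + a * d b}
  zero_mem' := by intro a b; simp
  add_mem' := by
    intro d e hd he a b
    simp only [LinearMap.add_apply, hd a b, he a b, add_mul, mul_add]
    abel
  smul_mem' := by
    intro c d hd a b
    simp only [LinearMap.smul_apply, hd a b, smul_add, smul_mul_assoc, mul_smul_comm]
  lie_mem' := by
    intro d e hd he a b
    have hd' : ∀ a b : U, d (a * b) = d a * b + a * d b := hd
    have he' : ∀ a b : U, e (a * b) = e a * b + a * e b := he
    simp only [LieRing.of_associative_ring_bracket, LinearMap.sub_apply, Module.End.mul_apply,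
      hd', he', map_add, sub_mul, mul_sub]
    abel

/-- The Lie ideal of inner derivations `v ↦ u v - v u`. -/
def Inn : LieIdeal k (Der k U) where
  carrier := {d | ∃ u : U, ∀ v : U, d.1 v = u * v - v * u}
  zero_mem' := ⟨0, by simp⟩
  add_mem' := by
    rintro d e ⟨u, hu⟩ ⟨w, hw⟩
    refine ⟨u + w, fun v => ?_⟩
    change d.1 v + e.1 v = _
    rw [hu, hw, add_mul, mul_add]
    abel
  smul_mem' := by
    rintro c d ⟨u, hu⟩
    refine ⟨c • u, fun v => ?_⟩
    change c • d.1 v = _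
    rw [hu, smul_sub, smul_mul_assoc, mul_smul_comm]
  lie_mem := by
    rintro d e ⟨u, hu⟩
    refine ⟨d.1 u, fun v => ?_⟩
    change d.1 (e.1 v) - e.1 (d.1 v) = _
    have hd : ∀ a b : U, d.1 (a * b) = d.1 a * b + a * d.1 b := d.2
    rw [hu, hu, map_sub, hd, hd]
    abel

/-- The Lie algebra of outer derivations. -/
abbrev Out : Type _ := Der k U ⧸ Inn k U

/-- The class of a derivation in `Out U`. -/
def Out.mk (d : Der k U) : Out k U := LieSubmodule.Quotient.mk d

end Out

/-! ### The first Hochschild cohomology, from the Hochschild cochain complex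
`U → Hom(U, U) → Hom(U ⊗ U, U)`, with its Gerstenhaber bracket -/

section HH1

variable (k : Type*) [CommRing k] (U : Type*) [Ring U] [Algebra k U]

/-- The Hochschild differential `C⁰ → C¹`, `u ↦ (a ↦ a u - u a)`. -/
def hochschildD0 : U →ₗ[k] Module.End k U :=
  (LinearMap.mul k U).flip - LinearMap.mul k U

/-- The Hochschild differential `C¹ → C²`, `f ↦ ((a, b) ↦ a f(b) - f(a b) + f(a) b)`. -/
def hochschildD1 : Module.End k U →ₗ[k] (U →ₗ[k] U →ₗ[k] U) where
  toFun f := LinearMap.mk₂ k (fun a b => a * f b - f (a * b) + f a * b)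
    (by intros; simp only [map_add, add_mul]; abel)
    (by intros; simp only [map_smul, smul_mul_assoc, smul_add, smul_sub])
    (by intros; simp only [map_add, mul_add]; abel)
    (by intros; simp only [map_smul, mul_smul_comm, smul_add, smul_sub])
  map_add' f g := by
    ext a b
    simp only [LinearMap.mk₂_apply, LinearMap.add_apply, mul_add, add_mul]
    abel
  map_smul' c f := by
    ext a b
    simp only [LinearMap.mk₂_apply, LinearMap.smul_apply, smul_add, smul_sub, smul_mul_assoc,
      mul_smul_comm, RingHom.id_apply]

theorem mem_ker_hochschildD1 (f : Module.End k U) :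
    f ∈ LinearMap.ker (hochschildD1 k U) ↔ f ∈ Der k U := by
  rw [LinearMap.mem_ker]
  constructor
  · intro h a b
    have h1 : a * f b - f (a * b) + f a * b = 0 := by
      simpa [hochschildD1] using LinearMap.congr_fun₂ h a b
    rw [← sub_eq_zero, ← neg_eq_zero, ← h1]
    abel
  · intro h
    ext a b
    have h1 : f (a * b) = f a * b + a * f b := h a b
    simp [hochschildD1, h1]

/-- The Hochschild 1-cocycles. The Gerstenhaber bracket of two 1-cochains is
`f ∘ g - g ∘ f`. -/
def hochschildZ1 : LieSubalgebra k (Module.End k U) where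
  __ := LinearMap.ker (hochschildD1 k U)
  lie_mem' := by
    intro f g hf hg
    have hf' := (mem_ker_hochschildD1 k U f).1 hf
    have hg' := (mem_ker_hochschildD1 k U g).1 hg
    exact (mem_ker_hochschildD1 k U _).2 ((Der k U).lie_mem hf' hg')

/-- The Hochschild 1-coboundaries. -/
def hochschildB1 : LieIdeal k (hochschildZ1 k U) where
  __ := (LinearMap.range (hochschildD0 k U)).comap (hochschildZ1 k U).toSubmodule.subtype
  lie_mem := by
    rintro f g ⟨u, hu⟩
    refine ⟨f.1 u, ?_⟩
    have hf : ∀ a b : U, f.1 (a * b) = f.1 a * b + a * f.1 b :=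
      (mem_ker_hochschildD1 k U f.1).1 f.2
    have hg : ∀ v : U, g.1 v = v * u - u * v := fun v => by
      simpa [hochschildD0] using (LinearMap.congr_fun hu v).symm
    ext v
    change v * f.1 u - f.1 u * v = f.1 (g.1 v) - g.1 (f.1 v)
    rw [hg, hg, map_sub, hf, hf]
    abel

/-- `HH¹(U)` as a Lie algebra. -/
abbrev HH1 : Type _ := hochschildZ1 k U ⧸ hochschildB1 k U

/-- The class of a 1-cocycle in `HH¹(U)`. -/
def HH1.mk (f : hochschildZ1 k U) : HH1 k U := LieSubmodule.Quotient.mk f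

end HH1

/-! ### Differential operators on a commutative algebra, and those tangent to `Q = 0` -/

section Diff

variable (k : Type*) [CommRing k] {S : Type*} [CommRing S] [Algebra k S]

/-- Multiplication by `s`, as an operator on `S`. -/
abbrev mulOp (s : S) : Module.End k S := LinearMap.mulLeft k s

variable {k}

/-- Grothendieck's definition: `P` is a differential operator of order `≤ 0` if it commutes
with all multiplications, and of order `≤ n + 1` if all its commutators with multiplications
are of order `≤ n`. -/
def IsDiffOp : ℕ → Module.End k S → Prop
  | 0, P => ∀ s : S, P * mulOp k s - mulOp k s * P = 0
  | n + 1, P => ∀ s : S, IsDiffOp n (P * mulOp k s - mulOp k s * P)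

theorem IsDiffOp.zero : ∀ n : ℕ, IsDiffOp n (0 : Module.End k S)
  | 0 => fun s => by simp
  | n + 1 => fun s => by simpa using IsDiffOp.zero n

theorem IsDiffOp.succ : ∀ {n : ℕ} {P : Module.End k S}, IsDiffOp n P → IsDiffOp (n + 1) P
  | 0, P, h => fun s => by rw [h s]; exact IsDiffOp.zero 0
  | _ + 1, _, h => fun s => (h s).succ

theorem IsDiffOp.mono {n m : ℕ} (hnm : n ≤ m) {P : Module.End k S} (h : IsDiffOp n P) :
    IsDiffOp m P := by
  induction hnm with
  | refl => exact h
  | step _ ih => exact ih.succ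

theorem IsDiffOp.add : ∀ {n : ℕ} {P R : Module.End k S}, IsDiffOp n P → IsDiffOp n R →
    IsDiffOp n (P + R)
  | 0, P, R, hP, hR => fun s => by
      rw [add_mul, mul_add, add_sub_add_comm, hP s, hR s, add_zero]
  | n + 1, P, R, hP, hR => fun s => by
      rw [add_mul, mul_add, add_sub_add_comm]
      exact (hP s).add (hR s)

theorem IsDiffOp.mul_zero_order : ∀ {m : ℕ} {P R : Module.End k S}, IsDiffOp 0 P →
    IsDiffOp m R → IsDiffOp m (P * R)
  | 0, P, R, hP, hR => fun s => by
      have h1 := sub_eq_zero.1 (hP s)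
      have h2 := sub_eq_zero.1 (hR s)
      rw [mul_assoc, h2, ← mul_assoc, h1, mul_assoc, sub_self]
  | m + 1, P, R, hP, hR => fun s => by
      have h1 := sub_eq_zero.1 (hP s)
      have : P * R * mulOp k s - mulOp k s * (P * R)
          = P * (R * mulOp k s - mulOp k s * R) := by
        rw [mul_sub, ← mul_assoc (mulOp k s), ← h1, mul_assoc, mul_assoc]
      rw [this]
      exact IsDiffOp.mul_zero_order hP (hR s)

theorem IsDiffOp.zero_order_mul : ∀ {n : ℕ} {P R : Module.End k S}, IsDiffOp n P →
    IsDiffOp 0 R → IsDiffOp n (P * R)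
  | 0, _, _, hP, hR => hP.mul_zero_order hR
  | n + 1, P, R, hP, hR => fun s => by
      have h1 := sub_eq_zero.1 (hR s)
      have : P * R * mulOp k s - mulOp k s * (P * R)
          = (P * mulOp k s - mulOp k s * P) * R := by
        rw [sub_mul, mul_assoc, h1, mul_assoc, mul_assoc]
      rw [this]
      exact IsDiffOp.zero_order_mul (hP s) hR

theorem IsDiffOp.mul : ∀ {n m : ℕ} {P R : Module.End k S}, IsDiffOp n P → IsDiffOp m R →
    IsDiffOp (n + m) (P * R)
  | 0, m, P, R, hP, hR => by rw [zero_add]; exact hP.mul_zero_order hR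
  | n + 1, 0, P, R, hP, hR => hP.zero_order_mul hR
  | n + 1, m + 1, P, R, hP, hR => fun s => by
      have e : P * R * mulOp k s - mulOp k s * (P * R)
          = P * (R * mulOp k s - mulOp k s * R)
            + (P * mulOp k s - mulOp k s * P) * R := by
        simp only [mul_sub, sub_mul, mul_assoc]
        abel
      rw [e]
      have h1 := IsDiffOp.mul hP (hR s)
      have h2 := IsDiffOp.mul (hP s) hR
      exact (h1.mono (by change n + 1 + m ≤ n + 1 + m; omega)).add
        (h2.mono (by change n + (m + 1) ≤ n + 1 + m; omega))

theorem isDiffOp_mulOp (s : S) : IsDiffOp 0 (mulOp k s) := fun r => by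
  ext v
  simp only [LinearMap.sub_apply, Module.End.mul_apply, LinearMap.mulLeft_apply,
    LinearMap.zero_apply]
  ring

theorem isDiffOp_derivation (θ : Derivation k S S) : IsDiffOp 1 (θ : S →ₗ[k] S) := fun s => by
  have : (θ : S →ₗ[k] S) * mulOp k s - mulOp k s * (θ : S →ₗ[k] S) = mulOp k (θ s) := by
    ext v
    simp only [LinearMap.sub_apply, Module.End.mul_apply, LinearMap.mulLeft_apply,
      Derivation.coeFn_coe, Derivation.leibniz, smul_eq_mul]
    ring
  rw [this]
  exact isDiffOp_mulOp _

variable (k)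

/-- For `Q` a defining polynomial of an arrangement `𝒜`, this is `Diff 𝒜`: the algebra of
differential operators on `S` preserving the ideal `Q S` and all its powers. -/
def DiffAlg (Q : S) : Subalgebra k (Module.End k S) where
  carrier := {P | (∃ n, IsDiffOp n P) ∧
    ∀ n : ℕ, ∀ s ∈ Ideal.span {Q} ^ n, P s ∈ Ideal.span {Q} ^ n}
  mul_mem' := by
    rintro P R ⟨⟨n, hP⟩, hP'⟩ ⟨⟨m, hR⟩, hR'⟩
    exact ⟨⟨n + m, hP.mul hR⟩, fun n s hs => hP' n _ (hR' n s hs)⟩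
  add_mem' := by
    rintro P R ⟨⟨n, hP⟩, hP'⟩ ⟨⟨m, hR⟩, hR'⟩
    exact ⟨⟨n + m, (hP.mono (by omega)).add (hR.mono (by omega))⟩,
      fun n s hs => add_mem (hP' n _ hs) (hR' n s hs)⟩
  algebraMap_mem' := by
    intro c
    have : algebraMap k (Module.End k S) c = mulOp k (algebraMap k S c) := by
      ext v
      simp [Algebra.smul_def]
    rw [this]
    exact ⟨⟨0, isDiffOp_mulOp _⟩, fun n s hs => Ideal.mul_mem_left _ _ hs⟩

/-- The element of `Diff 𝒜` given by multiplication by `s ∈ S`. -/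
def DiffAlg.ofMul (Q s : S) : DiffAlg k Q :=
  ⟨mulOp k s, ⟨0, isDiffOp_mulOp _⟩, fun _ _ hs => Ideal.mul_mem_left _ _ hs⟩

variable {k}

/-- The element of `Diff 𝒜` given by a derivation of `S` tangent to `𝒜`. -/
def DiffAlg.ofDer (Q : S) (θ : Derivation k S S) (h : Q ∣ θ Q) : DiffAlg k Q :=
  ⟨(θ : S →ₗ[k] S), ⟨1, isDiffOp_derivation θ⟩, fun n s hs => by
    rw [Ideal.span_singleton_pow, Ideal.mem_span_singleton] at hs ⊢
    obtain ⟨r, rfl⟩ := hs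
    obtain ⟨q, hq⟩ := h
    refine ⟨θ r + n * q * r, ?_⟩
    rw [Derivation.coeFn_coe, Derivation.leibniz, Derivation.leibniz_pow, hq]
    rcases n with _ | n
    · simp
    · simp only [smul_eq_mul, nsmul_eq_mul, Nat.add_sub_cancel]
      ring⟩

end Diff

/-! ### The arrangement with defining polynomial `Q = x F`, `F = y (t x + y)` -/

section Normal

open MvPolynomial

variable {k : Type*} [Field k] (t : k)

/-- `F = y (t x + y)` in `k[x, y]`, where `x = X 0` and `y = X 1`. -/
def polyF : MvPolynomial (Fin 2) k := X 1 * (C t * X 0 + X 1)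

/-- `Q = x F`. -/
def polyQ : MvPolynomial (Fin 2) k := X 0 * polyF t

variable (k) in
/-- The Euler derivation `E = x ∂_x + y ∂_y`. -/
def derE : Derivation k (MvPolynomial (Fin 2) k) (MvPolynomial (Fin 2) k) :=
  (X 0 : MvPolynomial (Fin 2) k) • pderiv 0 + (X 1 : MvPolynomial (Fin 2) k) • pderiv 1

/-- The derivation `D = F ∂_y`. -/
def derD : Derivation k (MvPolynomial (Fin 2) k) (MvPolynomial (Fin 2) k) :=
  polyF t • pderiv 1

theorem dvd_derE : polyQ t ∣ derE k (polyQ t) := by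
  refine ⟨3, ?_⟩
  simp [derE, polyQ, polyF, Derivation.leibniz, pderiv_X]
  ring

theorem dvd_derD : polyQ t ∣ derD t (polyQ t) := by
  refine ⟨pderiv 1 (polyF t), ?_⟩
  simp [derD, polyQ, Derivation.leibniz, pderiv_X]
  ring

/-- `U = Diff 𝒜` for the arrangement with defining polynomial `x y (t x + y)`. -/
abbrev U : Type _ := DiffAlg k (polyQ t)

/-- The elements of `S` inside `U`. -/
def elS (s : MvPolynomial (Fin 2) k) : U t := DiffAlg.ofMul k (polyQ t) s

/-- `E` as an element of `U`. -/
def elE : U t := DiffAlg.ofDer (polyQ t) (derE k) (dvd_derE t)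

/-- `D` as an element of `U`. -/
def elD : U t := DiffAlg.ofDer (polyQ t) (derD t) (dvd_derD t)

/-- The conditions `∂_f(x) = ∂_f(y) = 0`, `∂_f(D) = (F / f) ∂f/∂y`, `∂_f(E) = 1`. The polynomial
`(F / f) ∂f/∂y` is the `g` with `f g = F ∂f/∂y` (it is `0` for `f = x`). -/
def IsPartial (f : MvPolynomial (Fin 2) k) (d : Der k (U t)) : Prop :=
  d.1 (elS t (X 0)) = 0 ∧ d.1 (elS t (X 1)) = 0 ∧
    (∃ g, f * g = polyF t * pderiv 1 f ∧ d.1 (elD t) = elS t g) ∧ d.1 (elE t) = 1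

/-- The three linear forms `f₁ = x`, `f₂ = y`, `f₃ = t x + y`. -/
def form : Fin 3 → MvPolynomial (Fin 2) k := ![X 0, X 1, C t * X 0 + X 1]

end Normal

end ThreeLines

end

noncomputable section

namespace ThreeLines

/-! ### Commutators with multiplications -/

section General

variable {k : Type*} [CommRing k] {S : Type*} [CommRing S] [Algebra k S]

/-! A linear change of coordinates brings any three lines to `x y (x + y) = 0`, so it suffices to
treat `Q = x y (t x + y)` with `t ≠ 0`.

Structure of `U`. An operator preserving the powers of `Q` preserves the powers of each linear
factor `f`, so its commutator with `f` is divisible by `f`. Dividing `[P, x]` by `x` lowers the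
order, and the quotient again preserves all these powers. By induction the quotient lies in the span
of the `D ^ c E ^ d`, and `[R, x] = [P, x]` can be solved in that span because `p(E) ↦ p(E + 1) -
p(E)` is onto. The difference `P - R` commutes with `x`; a second induction, with `[·, y]` divisible
by `F`, writes it in powers of `D`. Thus `U` is spanned over `S` by the `D ^ c E ^ d` (`mem_spanDE`)
and generated by `x`, `y`, `D`, `E`.

Upper bound. The operator `ad E` is diagonalizable with natural eigenvalues, and `x`, `y`, `D` have
weight one. Modulo inner derivations a derivation sends `E` to a scalar and keeps `x`, `y`, `D` in
weight one, where elements have the form `x p(E) + y q(E) + D r(E)`. A further inner derivation, by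
a polynomial in `E`, removes the `x`-component of the image of `x`. The relations `yx = xy`, `Dx =
xD`, `Dy = yD + t xy + y²` then leave only three scalars: the value at `E` and the two coefficients
of a linear form, the value at `D` (`eq_zero_of_relations`).

Lower bound. The conjugate `f⁻ⁿ P fⁿ` is a polynomial in `n` with coefficients in `U`; its linear
coefficient is a derivation of `U`, formally `[P, log f]` (`exists_der`). The three derivations so
obtained commute and no nontrivial combination is inner, so they give a basis of an abelian `Out`.
-/

theorem mulOp_mul (s : S) (P : Module.End k S) : mulOp k s * P = s • P := rfl

variable (k) in
/-- The commutator `P ↦ P a - a P` with the multiplication by `a`, which is `S`-linear. -/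
def adMul (a : S) : Module.End k S →ₗ[S] Module.End k S where
  toFun P := P * mulOp k a - mulOp k a * P
  map_add' P R := by rw [add_mul, mul_add]; abel
  map_smul' s P := by
    ext v
    simp
    ring

theorem adMul_def (a : S) (P : Module.End k S) :
    adMul k a P = P * mulOp k a - mulOp k a * P := rfl

theorem adMul_apply (a : S) (P : Module.End k S) (s : S) :
    adMul k a P s = P (a * s) - a * P s := rfl

theorem IsDiffOp.adMul {n : ℕ} {P : Module.End k S} (h : IsDiffOp (n + 1) P) (a : S) :
    IsDiffOp n (adMul k a P) := h a

theorem eq_mulOp_of_isDiffOp_zero {P : Module.End k S} (h : IsDiffOp 0 P) :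
    P = mulOp k (P 1) := by
  ext s
  have := LinearMap.congr_fun (h s) 1
  simpa [sub_eq_zero, mul_comm] using this

theorem derivation_mul_mulOp (θ : Derivation k S S) (s : S) :
    (θ : S →ₗ[k] S) * mulOp k s = mulOp k s * (θ : S →ₗ[k] S) + mulOp k (θ s) := by
  ext v
  simp [Module.End.mul_apply, mul_comm]

theorem IsDiffOp.of_smul [IsDomain S] {a : S} (ha : a ≠ 0) :
    ∀ {n : ℕ} {G : Module.End k S}, IsDiffOp n (a • G) → IsDiffOp n G
  | 0, G, h => fun s => by
      have h1 : a • ThreeLines.adMul k s G = 0 := by rw [← map_smul]; exact h s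
      ext v
      have := LinearMap.congr_fun h1 v
      simpa [ha, adMul_apply] using this
  | n + 1, G, h => fun s => by
      have h1 : IsDiffOp n (a • ThreeLines.adMul k s G) := by rw [← map_smul]; exact h s
      exact IsDiffOp.of_smul ha h1

theorem exists_smul_eq [IsDomain S] {a : S} (ha : a ≠ 0) {P : Module.End k S}
    (h : ∀ s, a ∣ P s) : ∃ G : Module.End k S, a • G = P := by
  choose g hg using h
  refine ⟨{ toFun := g, map_add' := fun s r => ?_, map_smul' := fun c s => ?_ }, ?_⟩
  · apply mul_left_cancel₀ ha
    rw [← hg, map_add, hg, hg, mul_add]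
  · apply mul_left_cancel₀ ha
    rw [← hg, map_smul, hg, RingHom.id_apply, mul_smul_comm]
  · ext s
    exact (hg s).symm

/-- The operator `P` preserves all powers of the ideal generated by `f`. -/
def PreservesPowers (f : S) (P : Module.End k S) : Prop := ∀ m s, f ^ m ∣ P (f ^ m * s)

theorem PreservesPowers.sub {f : S} {P R : Module.End k S} (hP : PreservesPowers f P)
    (hR : PreservesPowers f R) : PreservesPowers f (P - R) :=
  fun m s => dvd_sub (hP m s) (hR m s)

theorem PreservesPowers.pow_dvd_adMul {f : S} {P : Module.End k S} (hP : PreservesPowers f P)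
    (a : S) (m : ℕ) (s : S) : f ^ m ∣ adMul k a P (f ^ m * s) := by
  rw [adMul_apply, mul_left_comm]
  exact dvd_sub (hP m _) ((hP m s).mul_left _)

/-- In `P(f · fᵐ s) - f P(fᵐ s)` both terms contain `f ^ (m + 1)`. The extra factor is what lets
`[P, f]` be divided by `f` with a quotient that still preserves the powers of `f`. -/
theorem PreservesPowers.pow_succ_dvd_adMul {f : S} {P : Module.End k S}
    (hP : PreservesPowers f P) (m : ℕ) (s : S) : f ^ (m + 1) ∣ adMul k f P (f ^ m * s) := by
  rw [adMul_apply, ← mul_assoc, ← pow_succ']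
  refine dvd_sub (hP _ _) ?_
  rw [pow_succ']
  exact mul_dvd_mul_left _ (hP m s)

/-- Induction on the order, through `hᵐ P(fᵐ s) = P(Qᵐ s) - [P, hᵐ](fᵐ s)`: the first term lies in
`Qᵐ S`, the second in `fᵐ S` since the commutator has smaller order. As `f` is prime and does not
divide `h`, the factor `hᵐ` can be cancelled. -/
theorem PreservesPowers.of_mem_diffAlg [IsDomain S] {Q f h : S} (hf : Prime f) (hfh : ¬ f ∣ h)
    (hQ : Q = f * h) : ∀ {n : ℕ} {P : Module.End k S}, IsDiffOp n P → P ∈ DiffAlg k Q →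
      PreservesPowers f P
  | 0, P, hP, _ => fun m s => by
      rw [eq_mulOp_of_isDiffOp_zero hP, LinearMap.mulLeft_apply]
      exact (dvd_mul_right _ _).mul_left _
  | n + 1, P, hP, hPQ => fun m s => by
      have hc : adMul k (h ^ m) P ∈ DiffAlg k Q :=
        sub_mem (mul_mem hPQ (DiffAlg.ofMul k Q (h ^ m)).2)
          (mul_mem (DiffAlg.ofMul k Q (h ^ m)).2 hPQ)
      have h1 := PreservesPowers.of_mem_diffAlg hf hfh hQ (hP.adMul (h ^ m)) hc m s
      have h2 : f ^ m ∣ P (h ^ m * (f ^ m * s)) := by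
        have := hPQ.2 m (h ^ m * (f ^ m * s)) (by
          rw [Ideal.span_singleton_pow, Ideal.mem_span_singleton, hQ]
          exact ⟨s, by ring⟩)
        rw [Ideal.span_singleton_pow, Ideal.mem_span_singleton, hQ, mul_pow] at this
        exact (dvd_mul_right _ _).trans this
      rw [adMul_apply] at h1
      exact hf.pow_dvd_of_dvd_mul_left m (fun h3 => hfh (hf.dvd_of_dvd_pow h3))
        ((dvd_sub_right h2).1 h1)

end General

/-! ### Polynomials in `E` and the difference operator -/

section Shift

variable {k : Type*} [CommRing k] {A : Type*} [Ring A] [Algebra k A]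

open Polynomial

/-- If `e a = a (e + 1)` then `p(e) a = a p(e + 1)`. -/
theorem aeval_mul_of_shift {e a : A} (h : e * a = a * (e + 1)) (p : k[X]) :
    aeval e p * a = a * aeval e (p.comp (X + 1)) := by
  have h1 : aeval e (p.comp (X + 1)) = aeval (e + 1) p := by simp [aeval_comp]
  rw [h1]
  clear h1
  induction p using Polynomial.induction_on' with
  | add p q hp hq => simp [add_mul, mul_add, hp, hq]
  | monomial n c =>
    have h2 : SemiconjBy a ((e + 1) ^ n) (e ^ n) :=
      SemiconjBy.pow_right (show SemiconjBy a (e + 1) e from h.symm) n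
    rw [aeval_monomial, aeval_monomial, mul_assoc, ← h2.eq, ← mul_assoc, ← mul_assoc,
      Algebra.commutes]

/-- The difference operator on polynomials is onto in characteristic zero. -/
theorem exists_comp_sub_eq {k : Type*} [Field k] [CharZero k] (q : k[X]) :
    ∃ p : k[X], p.comp (X + 1) - p = q := by
  induction q using Polynomial.induction_on' with
  | add p q hp hq =>
    obtain ⟨p', hp⟩ := hp
    obtain ⟨q', hq⟩ := hq
    exact ⟨p' + q', by rw [add_comp, ← hp, ← hq]; ring⟩
  | monomial n c =>
    -- Bernoulli polynomials satisfy `B_{n+1}(X + 1) - B_{n+1}(X) = (n + 1) Xⁿ`.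
    have h := congrArg (Polynomial.map (algebraMap ℚ k)) (bernoulli_comp_one_add_X (n + 1))
    refine ⟨C (c / (n + 1)) * (Polynomial.bernoulli (n + 1)).map (algebraMap ℚ k), ?_⟩
    have hn : (n + 1 : k) ≠ 0 := by exact_mod_cast n.succ_ne_zero
    rw [Polynomial.map_comp] at h
    simp only [Polynomial.map_add, Polynomial.map_one, map_X] at h
    rw [mul_comp, C_comp, ← mul_sub, add_comm X 1, h, add_sub_cancel_left]
    have h3 : C c = (C (c / (n + 1)) * C ((n : k) + 1) : k[X]) := by
      rw [← C_mul, div_mul_cancel₀ _ hn]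
    rw [← C_mul_X_pow_eq_monomial, h3]
    simp [mul_assoc]

end Shift

end ThreeLines

end

noncomputable section

namespace ThreeLines

/-! ### `Diff 𝒜` is spanned over `S` by the products `D ^ c E ^ d` -/

section Span

open MvPolynomial

variable {k : Type*} [Field k] (t : k)

/-- The derivation `E` as an operator. -/
abbrev opE (k : Type*) [Field k] : Module.End k (MvPolynomial (Fin 2) k) := (derE k : _ →ₗ[k] _)

/-- The derivation `D` as an operator. -/
abbrev opD : Module.End k (MvPolynomial (Fin 2) k) := (derD t : _ →ₗ[k] _)

theorem derE_X (i : Fin 2) : derE k (X i) = X i := by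
  fin_cases i <;> simp [derE, pderiv_X]

theorem derD_X_zero : derD t (X 0) = 0 := by simp [derD, pderiv_X]

theorem derD_X_one : derD t (X 1) = polyF t := by simp [derD]

theorem derD_polyF : derD t (polyF t) = polyF t * pderiv 1 (polyF t) := by simp [derD]

theorem prime_form (i : Fin 3) : Prime (form t i) := by
  fin_cases i
  · exact X_prime
  · exact X_prime
  · refine UniqueFactorizationMonoid.irreducible_iff_prime.1 ?_
    let φ : MvPolynomial (Fin 2) k ≃ₐ[k] MvPolynomial (Fin 2) k :=
      AlgEquiv.ofAlgHom (aeval ![X 0, C t * X 0 + X 1]) (aeval ![X 0, X 1 - C t * X 0])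
        (by ext i : 1; fin_cases i <;> simp) (by ext i : 1; fin_cases i <;> simp)
    have h : form t 2 = φ (X 1) := by simp [φ, form]
    change Irreducible (form t 2)
    rw [h, MulEquiv.irreducible_iff]
    exact X_prime.irreducible

theorem not_dvd_of_eval {f g : MvPolynomial (Fin 2) k} (v : Fin 2 → k) (hf : eval v f = 0)
    (hg : eval v g ≠ 0) : ¬ f ∣ g := by
  rintro ⟨r, rfl⟩
  exact hg (by rw [map_mul, hf, zero_mul])

theorem not_form_dvd {t : k} (ht : t ≠ 0) {i j : Fin 3} (hij : i ≠ j) :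
    ¬ form t i ∣ form t j := by
  fin_cases i
  · refine not_dvd_of_eval ![0, 1] (by simp [form]) ?_
    fin_cases j <;> simp_all [form]
  · refine not_dvd_of_eval ![1, 0] (by simp [form]) ?_
    fin_cases j <;> simp_all [form]
  · refine not_dvd_of_eval ![1, -t] (by simp [form]) ?_
    fin_cases j <;> simp_all [form]

theorem polyF_ne_zero : polyF t ≠ 0 :=
  mul_ne_zero (prime_form t 1).ne_zero (prime_form t 2).ne_zero

theorem preservesPowers_form {t : k} (ht : t ≠ 0) (i : Fin 3)
    {P : Module.End k (MvPolynomial (Fin 2) k)} (hP : P ∈ DiffAlg k (polyQ t)) :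
    PreservesPowers (form t i) P := by
  obtain ⟨n, hn⟩ := hP.1
  have key : ∀ j l : Fin 3, i ≠ j → i ≠ l → polyQ t = form t i * (form t j * form t l) →
      PreservesPowers (form t i) P := fun j l hj hl hQ =>
    PreservesPowers.of_mem_diffAlg (prime_form t i)
      (fun h => ((prime_form t i).dvd_or_dvd h).elim (not_form_dvd ht hj) (not_form_dvd ht hl))
      hQ hn hP
  fin_cases i
  · exact key 1 2 (by decide) (by decide) (by simp [polyQ, polyF, form])
  · exact key 0 2 (by decide) (by decide) (by simp [polyQ, polyF, form]; ring)
  · exact key 0 1 (by decide) (by decide) (by simp [polyQ, polyF, form]; ring)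

theorem opE_mul (i : Fin 2) : opE k * mulOp k (X i) = mulOp k (X i) * (opE k + 1) := by
  rw [derivation_mul_mulOp, derE_X, mul_add, mul_one]

theorem opD_mul_X_zero : opD t * mulOp k (X 0) = mulOp k (X 0) * opD t := by
  rw [derivation_mul_mulOp, derD_X_zero]; ext; simp

theorem opD_pow_mul_X_zero (c : ℕ) :
    opD t ^ c * mulOp k (X 0) = mulOp k (X 0) * opD t ^ c :=
  (Commute.pow_left (opD_mul_X_zero t) c).eq

theorem opD_mul_smul (s : MvPolynomial (Fin 2) k) (P : Module.End k (MvPolynomial (Fin 2) k)) :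
    opD t * s • P = s • (opD t * P) + derD t s • P := by
  rw [← mulOp_mul, ← mul_assoc, derivation_mul_mulOp, add_mul]
  rfl

/-- The left `S`-module spanned by the powers `D ^ c` with `c < n`. -/
def spanDLT (n : ℕ) :
    Submodule (MvPolynomial (Fin 2) k) (Module.End k (MvPolynomial (Fin 2) k)) :=
  Submodule.span _ ((fun c => opD t ^ c) '' Set.Iio n)

/-- The left `S`-module spanned by the powers of `D`. -/
def spanD : Submodule (MvPolynomial (Fin 2) k) (Module.End k (MvPolynomial (Fin 2) k)) :=
  Submodule.span _ (Set.range fun c => opD t ^ c)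

/-- The left `S`-module spanned by the products `D ^ c E ^ d`. -/
def spanDE : Submodule (MvPolynomial (Fin 2) k) (Module.End k (MvPolynomial (Fin 2) k)) :=
  Submodule.span _ (Set.range fun p : ℕ × ℕ => opD t ^ p.1 * opE k ^ p.2)

theorem spanD_le_spanDE : spanD t ≤ spanDE t := by
  refine Submodule.span_mono ?_
  rintro _ ⟨c, rfl⟩
  exact ⟨(c, 0), by simp⟩

theorem spanDLT_mono {m n : ℕ} (h : m ≤ n) : spanDLT t m ≤ spanDLT t n :=
  Submodule.span_mono (Set.image_mono (Set.Iio_subset_Iio h))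

theorem opD_pow_mem_spanDLT {c n : ℕ} (h : c < n) : opD t ^ c ∈ spanDLT t n :=
  Submodule.subset_span ⟨c, h, rfl⟩

theorem opD_mul_mem_spanDLT {n : ℕ} {P : Module.End k (MvPolynomial (Fin 2) k)}
    (hP : P ∈ spanDLT t n) : opD t * P ∈ spanDLT t (n + 1) := by
  induction hP using Submodule.span_induction with
  | mem P hP =>
    obtain ⟨c, hc, rfl⟩ := hP
    change opD t * opD t ^ c ∈ _
    rw [← pow_succ']
    exact opD_pow_mem_spanDLT t (Nat.succ_lt_succ hc)
  | zero => simp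
  | add P R _ _ hP hR => rw [mul_add]; exact add_mem hP hR
  | smul s P hP hP' =>
    rw [opD_mul_smul]
    exact add_mem (Submodule.smul_mem _ _ hP')
      (Submodule.smul_mem _ _ (spanDLT_mono t n.le_succ hP))

/-- The factor `F` survives the induction because `D F = F ∂_y F`, so moving `D` past `F` creates
only multiples of `F`. Only the leading coefficient `c + 1` matters afterwards. -/
theorem exists_adMul_opD_pow (c : ℕ) : ∃ L ∈ spanDLT t c,
    adMul k (X 1) (opD t ^ (c + 1)) = polyF t • (((c + 1 : ℕ) : k) • opD t ^ c + L) := by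
  induction c with
  | zero =>
    refine ⟨0, zero_mem _, ?_⟩
    rw [adMul_def, zero_add, pow_one, derivation_mul_mulOp, derD_X_one]
    ext; simp
  | succ c ih =>
    obtain ⟨L, hL, h⟩ := ih
    refine ⟨opD t * L + pderiv 1 (polyF t) • (((c + 1 : ℕ) : k) • opD t ^ c + L), ?_, ?_⟩
    · refine add_mem (opD_mul_mem_spanDLT t hL) (Submodule.smul_mem _ _ (add_mem ?_ ?_))
      · exact Submodule.smul_of_tower_mem _ _ (opD_pow_mem_spanDLT t c.lt_succ_self)
      · exact spanDLT_mono t c.le_succ hL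
    · have h1 : adMul k (X 1) (opD t ^ (c + 1 + 1)) =
          opD t * adMul k (X 1) (opD t ^ (c + 1)) + polyF t • opD t ^ (c + 1) := by
        have h2 := derivation_mul_mulOp (derD t) (X 1)
        rw [derD_X_one] at h2
        rw [adMul_def, adMul_def, pow_succ' _ (c + 1), mul_sub, ← mul_assoc (opD t) (mulOp k _),
          h2, ← mulOp_mul]
        noncomm_ring
      rw [h1, h, opD_mul_smul, derD_polyF, mul_add, mul_smul_comm, ← pow_succ']
      push_cast
      simp only [smul_add, add_smul, mul_smul, one_smul]
      abel

/-- The system given by `exists_adMul_opD_pow` is triangular with diagonal entries `c + 1`,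
invertible in characteristic zero. -/
theorem exists_adMul_opD_eq [CharZero k] (c : ℕ) :
    ∃ R ∈ spanD t, adMul k (X 1) R = polyF t • opD t ^ c := by
  induction c using Nat.strong_induction_on with
  | _ c ih =>
    obtain ⟨L, hL, h⟩ := exists_adMul_opD_pow t c
    have hle : spanDLT t c ≤ ((spanD t).map (adMul k (X 1))).comap
        (LinearMap.lsmul _ _ (polyF t)) := by
      refine Submodule.span_le.2 ?_
      rintro _ ⟨j, hj, rfl⟩
      exact ih j hj
    obtain ⟨R, hR, hRL⟩ := hle hL
    have hc : ((c + 1 : ℕ) : k) ≠ 0 := by exact_mod_cast c.succ_ne_zero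
    refine ⟨(C (((c + 1 : ℕ) : k)⁻¹) : MvPolynomial (Fin 2) k) • (opD t ^ (c + 1) - R),
      Submodule.smul_mem _ _ (sub_mem (Submodule.subset_span ⟨_, rfl⟩) hR), ?_⟩
    rw [map_smul, map_sub, h, hRL, LinearMap.lsmul_apply, smul_add, add_sub_cancel_right,
      smul_comm]
    congr 1
    refine LinearMap.ext fun v => ?_
    simp only [LinearMap.smul_apply, smul_eq_mul, ← smul_eq_C_mul, smul_smul, inv_mul_cancel₀ hc,
      one_smul]

theorem exists_adMul_X_one_eq [CharZero k] {G : Module.End k (MvPolynomial (Fin 2) k)}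
    (hG : G ∈ spanD t) : ∃ R ∈ spanD t, adMul k (X 1) R = polyF t • G := by
  have hle : spanD t ≤ ((spanD t).map (adMul k (X 1))).comap
      (LinearMap.lsmul _ _ (polyF t)) := by
    refine Submodule.span_le.2 ?_
    rintro _ ⟨j, rfl⟩
    exact exists_adMul_opD_eq t j
  exact hle hG

theorem opD_pow_mul_aeval_mem (c : ℕ) (p : Polynomial k) :
    opD t ^ c * Polynomial.aeval (opE k) p ∈ spanDE t := by
  induction p using Polynomial.induction_on' with
  | add p q hp hq => rw [map_add, mul_add]; exact add_mem hp hq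
  | monomial n a =>
    rw [Polynomial.aeval_monomial, ← Algebra.smul_def, mul_smul_comm]
    exact Submodule.smul_of_tower_mem _ _ (Submodule.subset_span ⟨(c, n), rfl⟩)

/-- Since `D` commutes with `x`, the commutator of `D ^ c p(E)` with `x` is `x D ^ c (p(E + 1) -
p(E))`, and every polynomial is such a difference. -/
theorem exists_adMul_X_zero_eq [CharZero k] {G : Module.End k (MvPolynomial (Fin 2) k)}
    (hG : G ∈ spanDE t) :
    ∃ R ∈ spanDE t, adMul k (X 0) R = (X 0 : MvPolynomial (Fin 2) k) • G := by
  have hle : spanDE t ≤ ((spanDE t).map (adMul k (X 0))).comap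
      (LinearMap.lsmul _ _ (X 0)) := by
    refine Submodule.span_le.2 ?_
    rintro _ ⟨⟨c, d⟩, rfl⟩
    obtain ⟨p, hp⟩ := exists_comp_sub_eq (Polynomial.X ^ d : Polynomial k)
    refine ⟨opD t ^ c * Polynomial.aeval (opE k) p, opD_pow_mul_aeval_mem t c p, ?_⟩
    rw [adMul_def, mul_assoc, aeval_mul_of_shift (opE_mul 0), ← mul_assoc, opD_pow_mul_X_zero,
      mul_assoc, ← mul_sub, ← mul_sub, ← map_sub, hp, map_pow, Polynomial.aeval_X]
    rfl
  exact hle hG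

theorem opE_mem : opE k ∈ DiffAlg k (polyQ t) := (elE t).2

theorem opD_mem : opD t ∈ DiffAlg k (polyQ t) := (elD t).2

theorem mem_diffAlg_of_mem_spanDE {P : Module.End k (MvPolynomial (Fin 2) k)}
    (hP : P ∈ spanDE t) :
    P ∈ DiffAlg k (polyQ t) := by
  induction hP using Submodule.span_induction with
  | mem P hP =>
    obtain ⟨c, rfl⟩ := hP
    exact mul_mem (pow_mem (opD_mem t) _) (pow_mem (opE_mem t) _)
  | zero => exact zero_mem _
  | add P R _ _ hP hR => exact add_mem hP hR
  | smul s P _ hP => exact mul_mem (elS t s).2 hP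

theorem eq_mulOp_of_adMul_eq_zero {P : Module.End k (MvPolynomial (Fin 2) k)}
    (h0 : adMul k (X 0) P = 0) (h1 : adMul k (X 1) P = 0) : P = mulOp k (P 1) := by
  apply eq_mulOp_of_isDiffOp_zero
  intro s
  rw [sub_eq_zero]
  induction s using MvPolynomial.induction_on with
  | C a =>
    refine LinearMap.ext fun v => ?_
    simp [← smul_eq_C_mul]
  | add p q hp hq =>
    have : mulOp k (p + q) = mulOp k p + mulOp k q := by ext; simp [add_mul]
    rw [this, mul_add, add_mul, hp, hq]
  | mul_X p i hp =>
    have : mulOp k (p * X i) = mulOp k p * mulOp k (X i) := by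
      ext; simp
    have hi : P * mulOp k (X i) = mulOp k (X i) * P := by
      rw [← sub_eq_zero]
      fin_cases i
      · exact h0
      · exact h1
    rw [this, ← mul_assoc, hp, mul_assoc, hi, mul_assoc]

theorem mem_spanD_of_adMul_eq_zero {P : Module.End k (MvPolynomial (Fin 2) k)}
    (h0 : adMul k (X 0) P = 0) (h1 : adMul k (X 1) P = 0) : P ∈ spanD t := by
  have h : P = P 1 • opD t ^ 0 := by
    rw [pow_zero, ← mulOp_mul, mul_one]
    exact eq_mulOp_of_adMul_eq_zero h0 h1
  rw [h]
  exact Submodule.smul_mem _ _ (Submodule.subset_span ⟨0, rfl⟩)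

theorem adMul_X_zero_eq_zero {P : Module.End k (MvPolynomial (Fin 2) k)} (hP : P ∈ spanD t) :
    adMul k (X 0) P = 0 := by
  have hle : spanD t ≤ LinearMap.ker (adMul k (X 0)) := by
    refine Submodule.span_le.2 ?_
    rintro _ ⟨c, rfl⟩
    exact sub_eq_zero.2 (opD_pow_mul_X_zero t c)
  exact hle hP

variable {t}

/-- Induction on the order: `[P, y] = F G` with `G` satisfying the same hypotheses, so `G` is a
combination of powers of `D`. Solving `[R, y] = F G` among such combinations leaves `P - R`
commuting with `x` and `y`, hence a multiplication. -/
theorem mem_spanD [CharZero k] (ht : t ≠ 0) :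
    ∀ {n : ℕ} {P : Module.End k (MvPolynomial (Fin 2) k)}, IsDiffOp n P →
      (∀ i, PreservesPowers (form t i) P) → adMul k (X 0) P = 0 → P ∈ spanD t
  | 0, _, hP, _, h0 => mem_spanD_of_adMul_eq_zero t h0 (hP _)
  | n + 1, P, hP, hf, h0 => by
    -- As `P` commutes with `x`, its commutators with `y` and `t x + y` coincide; hence both of
    -- these coprime forms divide the values of `[P, y]`.
    have hyz : adMul k (form t 2) P = adMul k (form t 1) P := by
      refine LinearMap.ext fun v => ?_
      have := LinearMap.congr_fun h0 v
      simp only [adMul_apply, LinearMap.zero_apply, form, Matrix.cons_val] at this ⊢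
      rw [add_mul, map_add, mul_assoc, ← smul_eq_C_mul, map_smul, smul_eq_C_mul,
        sub_eq_zero.1 this]
      ring
    have hF : polyF t = form t 1 * form t 2 := by simp [polyF, form]
    have hdiv : ∀ s, polyF t ∣ adMul k (X 1) P s := fun s => by
      have h1 := (hf 1).pow_succ_dvd_adMul 0 s
      have h2 := (hf 2).pow_succ_dvd_adMul 0 s
      rw [hyz] at h2
      simp only [zero_add, pow_one, pow_zero, one_mul] at h1 h2
      obtain ⟨r, hr⟩ := h1
      have h3 : adMul k (X 1) P s = form t 1 * r := hr
      rw [hr] at h2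
      rw [hF, h3]
      exact mul_dvd_mul_left _
        (((prime_form t 2).dvd_or_dvd h2).resolve_left (not_form_dvd ht (by decide)))
    obtain ⟨G, hG⟩ := exists_smul_eq (polyF_ne_zero t) hdiv
    have hGapp : ∀ v, form t 1 * form t 2 * G v = adMul k (form t 1) P v := fun v => by
      rw [← hF]; exact LinearMap.congr_fun hG v
    have hGn : IsDiffOp n G := by
      refine IsDiffOp.of_smul (polyF_ne_zero t) ?_
      rw [hG]
      exact hP.adMul _
    have hG0 : adMul k (X 0) G = 0 := by
      -- `F [G, x] = [[P, y], x] = [[P, x], y] = 0`.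
      have : polyF t • adMul k (X 0) G = 0 := by
        rw [← map_smul, hG]
        refine LinearMap.ext fun v => ?_
        have h5 := fun w => sub_eq_zero.1 (LinearMap.congr_fun h0 w)
        simp only [adMul_def, LinearMap.sub_apply, Module.End.mul_apply,
          LinearMap.mulLeft_apply, LinearMap.zero_apply] at h5 ⊢
        rw [h5, mul_left_comm (X 1) (X 0) v, h5]
        ring
      exact (smul_eq_zero.1 this).resolve_left (polyF_ne_zero t)
    have hGf : ∀ i, PreservesPowers (form t i) G := by
      intro i m s
      fin_cases i
      · have h1 := (hf 0).pow_dvd_adMul (form t 1) m s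
        rw [← hGapp] at h1
        refine (prime_form t 0).pow_dvd_of_dvd_mul_left m (fun h => ?_) h1
        exact ((prime_form t 0).dvd_or_dvd h).elim (not_form_dvd ht (by decide))
          (not_form_dvd ht (by decide))
      · have h1 := (hf 1).pow_succ_dvd_adMul m s
        rw [← hGapp, pow_succ', mul_assoc] at h1
        exact (prime_form t 1).pow_dvd_of_dvd_mul_left m (not_form_dvd ht (by decide))
          ((mul_dvd_mul_iff_left (prime_form t 1).ne_zero).1 h1)
      · have h1 := (hf 2).pow_succ_dvd_adMul m s
        rw [hyz, ← hGapp, pow_succ', mul_comm (form t 1), mul_assoc] at h1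
        exact (prime_form t 2).pow_dvd_of_dvd_mul_left m (not_form_dvd ht (by decide))
          ((mul_dvd_mul_iff_left (prime_form t 2).ne_zero).1 h1)
    obtain ⟨R, hR, hRG⟩ := exists_adMul_X_one_eq t (mem_spanD ht hGn hGf hG0)
    have h1 : P - R ∈ spanD t := by
      refine mem_spanD_of_adMul_eq_zero t ?_ ?_
      · rw [map_sub, h0, adMul_X_zero_eq_zero t hR, sub_zero]
      · rw [map_sub, hRG, hG, sub_self]
    simpa using add_mem h1 hR

/-- The same scheme with `x` in place of `y`: `[P, x] = x G` with `G` of smaller order, and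
correcting `P` by a solution `R` of `[R, x] = x G` reduces to `mem_spanD`. -/
theorem mem_spanDE_of_preservesPowers [CharZero k] (ht : t ≠ 0) :
    ∀ {n : ℕ} {P : Module.End k (MvPolynomial (Fin 2) k)}, IsDiffOp n P →
      (∀ i, PreservesPowers (form t i) P) → P ∈ spanDE t
  | 0, _, hP, _ => spanD_le_spanDE t (mem_spanD_of_adMul_eq_zero t (hP _) (hP _))
  | n + 1, P, hP, hf => by
    have hx : form t 0 ≠ 0 := (prime_form t 0).ne_zero
    have hdiv : ∀ s, form t 0 ∣ adMul k (form t 0) P s := fun s => by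
      simpa using (hf 0).pow_succ_dvd_adMul 0 s
    obtain ⟨G, hG⟩ := exists_smul_eq hx hdiv
    have hGapp : ∀ v, form t 0 * G v = adMul k (form t 0) P v := LinearMap.congr_fun hG
    have hGn : IsDiffOp n G := by
      refine IsDiffOp.of_smul hx ?_
      rw [hG]
      exact hP.adMul _
    have hGf : ∀ i, PreservesPowers (form t i) G := by
      intro i m s
      by_cases hi : i = 0
      · subst hi
        have h1 := (hf 0).pow_succ_dvd_adMul m s
        rw [← hGapp, pow_succ'] at h1
        exact (mul_dvd_mul_iff_left hx).1 h1
      · have h1 := (hf i).pow_dvd_adMul (form t 0) m s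
        rw [← hGapp] at h1
        exact (prime_form t i).pow_dvd_of_dvd_mul_left m (not_form_dvd ht hi) h1
    obtain ⟨R, hR, hRG⟩ := exists_adMul_X_zero_eq t (mem_spanDE_of_preservesPowers ht hGn hGf)
    have hRU := mem_diffAlg_of_mem_spanDE t hR
    obtain ⟨r, hr⟩ := hRU.1
    have hneg : IsDiffOp r (-R) := by
      have : -R = mulOp k (-1) * R := by ext; simp
      rw [this]
      exact (isDiffOp_mulOp _).mul_zero_order hr
    have h1 : P - R ∈ spanD t := by
      -- The order of `R` is not controlled, which is harmless: `mem_spanD` applies at every order.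
      refine mem_spanD ht (n := n + 1 + r) ?_
        (fun i => (hf i).sub (preservesPowers_form ht i hRU)) ?_
      · rw [sub_eq_add_neg]
        exact (hP.mono (by omega)).add (hneg.mono (by omega))
      · rw [map_sub, hRG, sub_eq_zero]
        exact hG.symm
    simpa using add_mem (spanD_le_spanDE t h1) hR

/-- `Diff 𝒜` is spanned, as a left `S`-module, by the products `D ^ c E ^ d`. -/
theorem mem_spanDE [CharZero k] (ht : t ≠ 0) {P : Module.End k (MvPolynomial (Fin 2) k)}
    (hP : P ∈ DiffAlg k (polyQ t)) : P ∈ spanDE t := by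
  obtain ⟨n, hn⟩ := hP.1
  exact mem_spanDE_of_preservesPowers ht hn fun i => preservesPowers_form ht i hP

end Span

end ThreeLines

end

noncomputable section

namespace ThreeLines

/-! ### Spaces spanned by eigenvectors with natural eigenvalues -/

section Weights

variable {k M : Type*} [Field k] [CharZero k] [AddCommGroup M] [Module k M]
  {f : Module.End k M} {W : ℕ → Submodule k M}

/-- A diagonalizable operator has no Jordan block of size two. -/
theorem eq_zero_and_mem_of_apply_eq_sub (hW : ∀ j, ∀ w ∈ W j, f w = (j : k) • w)
    (hT : ⨆ j, W j = ⊤) {n : ℕ} {v r : M} (hr : f r = (n : k) • r)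
    (hv : f v = (n : k) • v - r) : r = 0 ∧ v ∈ W n := by
  obtain ⟨w, hw, rfl⟩ := (Submodule.mem_iSup_iff_exists_finsupp W v).1 (hT ▸ Submodule.mem_top)
  have hind : iSupIndep fun j : ℕ => f.eigenspace (j : k) :=
    f.eigenspaces_iSupIndep.comp Nat.cast_injective
  rw [iSupIndep_iff_finsetSum_eq_zero_imp_eq_zero] at hind
  -- The component of `f v - n v + r = 0` of eigenvalue `j`. At `j = n` it is `r`; elsewhere it is a
  -- nonzero multiple of `w j`.
  set g : ℕ → M := fun j => ((j : k) - n) • w j + if j = n then r else 0 with hg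
  have hgmem : ∀ j : ℕ, g j ∈ f.eigenspace (j : k) := fun j => by
    rw [Module.End.mem_eigenspace_iff, hg]
    by_cases hj : j = n
    · subst hj; simp [hr]
    · simp [hj, hW j _ (hw j), smul_comm (j : k)]
  have hsum : ∑ j ∈ insert n w.support, g j = 0 := by
    have hsub : w.support ⊆ insert n w.support := Finset.subset_insert _ _
    have h1 : ∑ j ∈ insert n w.support, w j = w.sum fun _ x => x :=
      (Finset.sum_subset hsub fun j _ hj => by simpa using hj).symm
    rw [← h1, map_sum] at hv
    rw [hg, Finset.sum_add_distrib, Finset.sum_ite_eq' _ n, if_pos (Finset.mem_insert_self _ _)]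
    have h2 : ∑ j ∈ insert n w.support, ((j : k) - n) • w j =
        ∑ j ∈ insert n w.support, f (w j) - (n : k) • ∑ j ∈ insert n w.support, w j := by
      rw [Finset.smul_sum, ← Finset.sum_sub_distrib]
      exact Finset.sum_congr rfl fun j _ => by rw [hW j _ (hw j), sub_smul]
    rw [h2, hv]
    abel
  have hzero : ∀ j ∈ insert n w.support, g j = 0 := hind _ g (fun j _ => hgmem j) hsum
  refine ⟨by simpa [hg] using hzero n (Finset.mem_insert_self _ _), ?_⟩
  refine sum_mem fun j hj => ?_
  by_cases hjn : j = n
  · subst hjn; exact hw j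
  · have h3 := hzero j (Finset.mem_insert_of_mem hj)
    have h4 : ((j : k) - n) ≠ 0 := sub_ne_zero.2 (by exact_mod_cast hjn)
    have h5 : w j = 0 := by simpa [hg, hjn, h4] using h3
    change w j ∈ _
    rw [h5]
    exact zero_mem _

theorem exists_eq_add_apply (hW : ∀ j, ∀ w ∈ W j, f w = (j : k) • w) (hT : ⨆ j, W j = ⊤)
    (v : M) : ∃ w ∈ W 0, ∃ u, v = w + f u := by
  have hv : v ∈ ⨆ j, W j := hT ▸ Submodule.mem_top
  induction hv using Submodule.iSup_induction' with
  | mem j v hv =>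
    by_cases hj : j = 0
    · subst hj
      exact ⟨v, hv, 0, by simp⟩
    · refine ⟨0, zero_mem _, (j : k)⁻¹ • v, ?_⟩
      have : (j : k) ≠ 0 := by exact_mod_cast hj
      rw [map_smul, hW j v hv, smul_smul, inv_mul_cancel₀ this, one_smul, zero_add]
  | zero => exact ⟨0, zero_mem _, 0, by simp⟩
  | add v w _ _ hv hw =>
    obtain ⟨a, ha, b, rfl⟩ := hv
    obtain ⟨c, hc, e, rfl⟩ := hw
    exact ⟨a + c, add_mem ha hc, b + e, by rw [map_add]; abel⟩

end Weights

/-! ### Relations, weights for `ad E`, and independence in weight two -/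

section Structure

open MvPolynomial

variable {k : Type*} [Field k] {t : k}

theorem elS_add (a b : MvPolynomial (Fin 2) k) : elS t (a + b) = elS t a + elS t b :=
  Subtype.ext (LinearMap.ext fun v => add_mul a b v)

theorem elS_mul (a b : MvPolynomial (Fin 2) k) : elS t (a * b) = elS t a * elS t b :=
  Subtype.ext (LinearMap.ext fun v => mul_assoc a b v)

theorem elS_smul (c : k) (a : MvPolynomial (Fin 2) k) : elS t (c • a) = c • elS t a :=
  Subtype.ext (LinearMap.ext fun v => smul_mul_assoc c a v)

theorem elS_one : elS t 1 = 1 :=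
  Subtype.ext (LinearMap.ext fun v => one_mul v)

theorem elS_zero : elS t 0 = 0 :=
  Subtype.ext (LinearMap.ext fun v => zero_mul v)

theorem elS_C (c : k) : elS t (C c) = algebraMap k (U t) c := by
  rw [← mul_one (C c), ← smul_eq_C_mul, elS_smul, elS_one, Algebra.algebraMap_eq_smul_one]

theorem elS_pow (a : MvPolynomial (Fin 2) k) (n : ℕ) : elS t (a ^ n) = elS t a ^ n := by
  induction n with
  | zero => simp [elS_one]
  | succ n ih => rw [pow_succ, pow_succ, elS_mul, ih]

theorem elS_injective : Function.Injective (elS t) := fun a b h => by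
  simpa [elS, DiffAlg.ofMul] using LinearMap.congr_fun (congrArg Subtype.val h) 1

theorem elE_mul_elS (s : MvPolynomial (Fin 2) k) :
    elE t * elS t s = elS t s * elE t + elS t (derE k s) :=
  Subtype.ext (derivation_mul_mulOp (derE k) s)

theorem elD_mul_elS (s : MvPolynomial (Fin 2) k) :
    elD t * elS t s = elS t s * elD t + elS t (derD t s) :=
  Subtype.ext (derivation_mul_mulOp (derD t) s)

theorem derE_polyF : derE k (polyF t) = 2 * polyF t := by
  simp [derE, polyF, Derivation.leibniz, pderiv_X]
  ring

theorem elE_mul_elD : elE t * elD t = elD t * (elE t + 1) := by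
  have h : ⁅derE k, derD t⁆ = derD t := by
    apply MvPolynomial.derivation_ext
    intro i
    fin_cases i
    · simp [Derivation.commutator_apply, derE_X, derD_X_zero]
    · simp only [Derivation.commutator_apply, Fin.mk_one, derE_X, derD_X_one, derE_polyF]
      ring
  apply Subtype.ext
  refine LinearMap.ext fun v => ?_
  have h1 := congrArg (fun θ => θ v) h
  simp only [Derivation.commutator_apply, sub_eq_iff_eq_add] at h1
  change derE k (derD t v) = derD t (derE k v + v)
  rw [h1, map_add, add_comm]

theorem elE_mul_X (i : Fin 2) : elE t * elS t (X i) = elS t (X i) * (elE t + 1) := by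
  rw [elE_mul_elS, derE_X, mul_add, mul_one]

theorem coeff_derE (s : MvPolynomial (Fin 2) k) (m : Fin 2 →₀ ℕ) :
    coeff m (derE k s) = (m 0 + m 1 : k) * coeff m s := by
  have h : ∀ (i : Fin 2) (u : Fin 2 →₀ ℕ) (a : k),
      X i * pderiv i (monomial u a) = (u i : k) • monomial u a := by
    intro i u a
    rw [X_mul_pderiv_monomial, Nat.cast_smul_eq_nsmul]
  induction s using MvPolynomial.induction_on' with
  | monomial u a =>
    have : derE k (monomial u a) = ((u 0 : k) + u 1) • monomial u a := by
      rw [derE, Derivation.add_apply, Derivation.smul_apply, Derivation.smul_apply, smul_eq_mul,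
        smul_eq_mul, h, h, add_smul]
    rw [this, coeff_smul, smul_eq_mul, coeff_monomial]
    split_ifs with h1
    · rw [h1]
    · simp
  | add p q hp hq => rw [map_add, coeff_add, coeff_add, hp, hq, mul_add]

theorem derE_of_isHomogeneous {s : MvPolynomial (Fin 2) k} {n : ℕ} (hs : s.IsHomogeneous n) :
    derE k s = (n : k) • s := by
  ext m
  rw [coeff_derE, coeff_smul, smul_eq_mul]
  by_cases h : coeff m s = 0
  · simp [h]
  · have := hs h
    rw [← this, Finsupp.weight_apply, Finsupp.sum_fintype _ _ (by simp)]
    simp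

theorem eq_C_of_derE_eq_C [CharZero k] {s : MvPolynomial (Fin 2) k} {c : k}
    (h : derE k s = C c) : c = 0 ∧ ∃ a, s = C a := by
  have h0 := coeff_derE s 0
  rw [h] at h0
  have hc : c = 0 := by simpa using h0
  refine ⟨hc, coeff 0 s, ?_⟩
  ext m
  rw [coeff_C]
  split_ifs with hm
  · rw [hm]
  · have h1 := coeff_derE s m
    rw [h, hc, map_zero, coeff_zero] at h1
    have h2 : ((m 0 : k) + m 1) ≠ 0 := by
      intro h3
      apply hm
      have h4 : m 0 + m 1 = 0 := by exact_mod_cast h3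
      ext i
      fin_cases i <;> simp <;> omega
    simpa [h2] using h1.symm

/-- The span of the elements `s D ^ c E ^ d` of weight `j`. -/
def weightSpace (t : k) (j : ℕ) : Submodule k (U t) :=
  Submodule.span k {u | ∃ a c d s, s.IsHomogeneous a ∧ a + c = j ∧
    u = elS t s * elD t ^ c * elE t ^ d}

/-- The commutator with `E`. -/
def adE (t : k) : Module.End k (U t) := LinearMap.mulLeft k (elE t) - LinearMap.mulRight k (elE t)

theorem adE_apply (u : U t) : adE t u = elE t * u - u * elE t := rfl

theorem adE_mul (u v : U t) : adE t (u * v) = adE t u * v + u * adE t v := by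
  simp only [adE_apply, sub_mul, mul_sub, mul_assoc]
  abel

theorem adE_elS {s : MvPolynomial (Fin 2) k} {n : ℕ} (hs : s.IsHomogeneous n) :
    adE t (elS t s) = (n : k) • elS t s := by
  rw [adE_apply, elE_mul_elS, derE_of_isHomogeneous hs, elS_smul]
  abel

theorem adE_elD_pow (c : ℕ) : adE t (elD t ^ c) = (c : k) • elD t ^ c := by
  induction c with
  | zero => simp [adE_apply]
  | succ c ih =>
    have : adE t (elD t) = elD t := by rw [adE_apply, elE_mul_elD]; noncomm_ring
    rw [pow_succ, adE_mul, ih, this, smul_mul_assoc]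
    push_cast
    module

theorem adE_of_mem_weightSpace (j : ℕ) (u : U t) (hu : u ∈ weightSpace t j) :
    adE t u = (j : k) • u := by
  induction hu using Submodule.span_induction with
  | mem u hu =>
    obtain ⟨a, c, d, s, hs, rfl, rfl⟩ := hu
    have : adE t (elE t ^ d) = 0 := by rw [adE_apply, ← pow_succ, ← pow_succ', sub_self]
    rw [adE_mul, adE_mul, adE_elS hs, adE_elD_pow, this]
    push_cast
    simp only [smul_mul_assoc, mul_smul_comm, add_mul, mul_zero]
    module
  | zero => simp
  | add u v _ _ hu hv => rw [map_add, hu, hv, smul_add]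
  | smul c u _ hu => rw [map_smul, hu, smul_comm]

theorem elS_mul_mem_weightSpace {s : MvPolynomial (Fin 2) k} {b j : ℕ} (hs : s.IsHomogeneous b)
    {u : U t} (hu : u ∈ weightSpace t j) : elS t s * u ∈ weightSpace t (b + j) := by
  induction hu using Submodule.span_induction with
  | mem u hu =>
    obtain ⟨a, c, d, r, hr, rfl, rfl⟩ := hu
    refine Submodule.subset_span ⟨b + a, c, d, s * r, hs.mul hr, by ring, ?_⟩
    rw [elS_mul]
    noncomm_ring
  | zero => simp
  | add u v _ _ hu hv => rw [mul_add]; exact add_mem hu hv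
  | smul c u _ hu => rw [mul_smul_comm]; exact Submodule.smul_mem _ _ hu

theorem elS_mul_mem_iSup_weightSpace (s : MvPolynomial (Fin 2) k) {u : U t}
    (hu : u ∈ ⨆ j, weightSpace t j) : elS t s * u ∈ ⨆ j, weightSpace t j := by
  induction s using MvPolynomial.induction_on' with
  | monomial m a =>
    induction hu using Submodule.iSup_induction' with
    | mem j u hu =>
      exact Submodule.mem_iSup_of_mem _ (elS_mul_mem_weightSpace (isHomogeneous_monomial a rfl) hu)
    | zero => simp
    | add u v _ _ hu hv => rw [mul_add]; exact add_mem hu hv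
  | add p q hp hq => rw [elS_add, add_mul]; exact add_mem hp hq

theorem iSup_weightSpace [CharZero k] (ht : t ≠ 0) : ⨆ j, weightSpace t j = ⊤ := by
  rw [eq_top_iff]
  rintro ⟨P, hP⟩ -
  suffices ∃ u ∈ ⨆ j, weightSpace t j, u.1 = P by
    obtain ⟨u, hu, rfl⟩ := this
    exact hu
  have hP' := mem_spanDE ht hP
  clear hP
  induction hP' using Submodule.span_induction with
  | mem P hP =>
    obtain ⟨⟨c, d⟩, rfl⟩ := hP
    refine ⟨elS t 1 * elD t ^ c * elE t ^ d, Submodule.mem_iSup_of_mem c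
      (Submodule.subset_span ⟨0, c, d, 1, isHomogeneous_one _ _, zero_add c, rfl⟩), ?_⟩
    rw [elS_one, one_mul]
    rfl
  | zero => exact ⟨0, zero_mem _, rfl⟩
  | add P R _ _ hP hR =>
    obtain ⟨u, hu, rfl⟩ := hP
    obtain ⟨v, hv, rfl⟩ := hR
    exact ⟨u + v, add_mem hu hv, rfl⟩
  | smul s P _ hP =>
    obtain ⟨u, hu, rfl⟩ := hP
    exact ⟨elS t s * u, elS_mul_mem_iSup_weightSpace s hu, rfl⟩

theorem exists_eq_of_isHomogeneous_one {s : MvPolynomial (Fin 2) k} (hs : s.IsHomogeneous 1) :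
    ∃ a b : k, s = a • X 0 + b • X 1 := by
  have h : s ∈ homogeneousSubmodule (Fin 2) k 1 := hs
  rw [homogeneousSubmodule_one_eq_span_X] at h
  have : Set.range (X : Fin 2 → MvPolynomial (Fin 2) k) = {X 0, X 1} := by
    ext; simp [Fin.exists_fin_two, eq_comm]
  rw [this, Submodule.mem_span_pair] at h
  obtain ⟨a, b, h⟩ := h
  exact ⟨a, b, h.symm⟩

/-- Elements of weight one are of the form `x p(E) + y q(E) + D r(E)`. -/
theorem exists_of_mem_weightSpace_one {u : U t} (hu : u ∈ weightSpace t 1) :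
    ∃ p q r : Polynomial k, u = elS t (X 0) * Polynomial.aeval (elE t) p +
      elS t (X 1) * Polynomial.aeval (elE t) q + elD t * Polynomial.aeval (elE t) r := by
  induction hu using Submodule.span_induction with
  | mem u hu =>
    obtain ⟨a, c, d, s, hs, hac, rfl⟩ := hu
    obtain ⟨rfl, rfl⟩ | ⟨rfl, rfl⟩ : (a = 1 ∧ c = 0) ∨ (a = 0 ∧ c = 1) := by omega
    · obtain ⟨α, β, rfl⟩ := exists_eq_of_isHomogeneous_one hs
      refine ⟨α • Polynomial.X ^ d, β • Polynomial.X ^ d, 0, ?_⟩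
      simp [elS_add, elS_smul, add_mul]
    · rw [← totalDegree_zero_iff_isHomogeneous, totalDegree_eq_zero_iff_eq_C] at hs
      refine ⟨0, 0, coeff 0 s • Polynomial.X ^ d, ?_⟩
      rw [hs, elS_C, ← Algebra.smul_def]
      simp
  | zero => exact ⟨0, 0, 0, by simp⟩
  | add u v _ _ hu hv =>
    obtain ⟨p, q, r, rfl⟩ := hu
    obtain ⟨p', q', r', rfl⟩ := hv
    exact ⟨p + p', q + q', r + r', by simp only [map_add, mul_add]; abel⟩
  | smul c u _ hu =>
    obtain ⟨p, q, r, rfl⟩ := hu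
    exact ⟨c • p, c • q, c • r, by simp only [map_smul, mul_smul_comm, smul_add]⟩

theorem aeval_opE_apply (p : Polynomial k) {s : MvPolynomial (Fin 2) k} {n : ℕ}
    (hs : s.IsHomogeneous n) : Polynomial.aeval (opE k) p s = p.eval (n : k) • s := by
  have h1 : opE k s = (n : k) • s := derE_of_isHomogeneous hs
  induction p using Polynomial.induction_on with
  | C a => simp [Module.algebraMap_end_apply]
  | add p q hp hq => rw [map_add, LinearMap.add_apply, hp, hq, Polynomial.eval_add, add_smul]
  | monomial m a h =>
    rw [pow_succ, ← mul_assoc, map_mul, Polynomial.aeval_X, Module.End.mul_apply, h1, map_smul, h,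
      smul_smul, Polynomial.eval_mul_X, mul_comm]

theorem coe_aeval_elE (p : Polynomial k) :
    (Polynomial.aeval (elE t) p : U t).1 = Polynomial.aeval (opE k) p :=
  Polynomial.aeval_algHom_apply (DiffAlg k (polyQ t)).val (elE t) p |>.symm

theorem polynomial_eq_zero_of_eval_natCast [CharZero k] {p : Polynomial k} (m : ℕ)
    (h : ∀ n : ℕ, p.eval ((n + m : ℕ) : k) = 0) : p = 0 := by
  refine Polynomial.eq_zero_of_infinite_isRoot p ?_
  refine (Set.infinite_range_of_injective
    (f := fun n : ℕ => ((n + m : ℕ) : k)) fun a b hab => ?_).mono ?_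
  · simpa using hab
  · rintro _ ⟨n, rfl⟩
    exact h n

/-- The elements `x²`, `xy`, `y²`, `xD` and `yD` are right independent over `k[E]`. -/
theorem eq_zero_of_sum_eq_zero [CharZero k] {p₁ p₂ p₃ p₄ p₅ : Polynomial k}
    (h : elS t (X 0) * (elS t (X 0) * Polynomial.aeval (elE t) p₁) +
      elS t (X 0) * (elS t (X 1) * Polynomial.aeval (elE t) p₂) +
      elS t (X 1) * (elS t (X 1) * Polynomial.aeval (elE t) p₃) +
      elS t (X 0) * (elD t * Polynomial.aeval (elE t) p₄) +
      elS t (X 1) * (elD t * Polynomial.aeval (elE t) p₅) = 0) :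
    p₁ = 0 ∧ p₂ = 0 ∧ p₃ = 0 ∧ p₄ = 0 ∧ p₅ = 0 := by
  -- On forms of degree `n`, `p(E)` acts as the scalar `p(n)`.
  have happ : ∀ (n : ℕ) (s : MvPolynomial (Fin 2) k), s.IsHomogeneous n →
      (p₁.eval (n : k) • X 0 ^ 2 + p₂.eval (n : k) • (X 0 * X 1) +
        p₃.eval (n : k) • X 1 ^ 2) * s + (p₄.eval (n : k) • X 0 + p₅.eval (n : k) • X 1) *
          derD t s = 0 := by
    intro n s hs
    have h1 := LinearMap.congr_fun (congrArg Subtype.val h) s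
    have h2 : ∀ p : Polynomial k, (Polynomial.aeval (elE t) p : U t).1 s = p.eval (n : k) • s :=
      fun p => by rw [coe_aeval_elE, aeval_opE_apply p hs]
    change X 0 * (X 0 * (Polynomial.aeval (elE t) p₁ : U t).1 s) +
      X 0 * (X 1 * (Polynomial.aeval (elE t) p₂ : U t).1 s) +
      X 1 * (X 1 * (Polynomial.aeval (elE t) p₃ : U t).1 s) +
      X 0 * derD t ((Polynomial.aeval (elE t) p₄ : U t).1 s) +
      X 1 * derD t ((Polynomial.aeval (elE t) p₅ : U t).1 s) = 0 at h1
    simp only [h2, Derivation.map_smul] at h1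
    rw [← h1]
    simp only [smul_eq_C_mul]
    ring
  have hX : ∀ n : ℕ, (X 0 ^ n : MvPolynomial (Fin 2) k) ≠ 0 := fun n => pow_ne_zero _ (X_ne_zero 0)
  have hDX : ∀ n : ℕ, derD t (X 0 ^ n) = 0 := fun n => by
    rw [Derivation.leibniz_pow, derD_X_zero]; simp
  -- `D` kills `xⁿ`, which isolates the quadratic part; three points then separate its coefficients.
  have hq : ∀ n : ℕ, p₁.eval (n : k) = 0 ∧ p₂.eval (n : k) = 0 ∧ p₃.eval (n : k) = 0 := by
    intro n
    have h1 := happ n (X 0 ^ n) (by simpa using (isHomogeneous_X k (0 : Fin 2)).pow n)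
    rw [hDX, mul_zero, add_zero] at h1
    have h2 := (mul_eq_zero.1 h1).resolve_right (hX n)
    have h3 := congrArg (eval ![1, 0]) h2
    have h4 := congrArg (eval ![0, 1]) h2
    have h5 := congrArg (eval ![1, 1]) h2
    simp [smul_eval] at h3 h4 h5
    simp [h3, h4] at h5
    exact ⟨h3, h5, h4⟩
  -- The test form is `xⁿ y`, sent by `D` to `xⁿ F`; its degree `n + 1` accounts for the shift.
  have hl : ∀ n : ℕ, p₄.eval ((n + 1 : ℕ) : k) = 0 ∧ p₅.eval ((n + 1 : ℕ) : k) = 0 := by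
    intro n
    have h1 := happ (n + 1) (X 0 ^ n * X 1)
      (by simpa using ((isHomogeneous_X k (0 : Fin 2)).pow n).mul (isHomogeneous_X k (1 : Fin 2)))
    obtain ⟨e1, e2, e3⟩ := hq (n + 1)
    rw [Derivation.leibniz, hDX, derD_X_one, e1, e2, e3] at h1
    simp only [zero_smul, add_zero, zero_mul, zero_add, mul_zero, smul_eq_mul] at h1
    have h2 := (mul_eq_zero.1 h1).resolve_right (mul_ne_zero (hX n) (polyF_ne_zero t))
    have h3 := congrArg (eval ![1, 0]) h2
    have h4 := congrArg (eval ![0, 1]) h2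
    simp [smul_eval] at h3 h4
    push_cast
    exact ⟨h3, h4⟩
  exact ⟨polynomial_eq_zero_of_eval_natCast 0 fun n => (hq n).1,
    polynomial_eq_zero_of_eval_natCast 0 fun n => (hq n).2.1,
    polynomial_eq_zero_of_eval_natCast 0 fun n => (hq n).2.2,
    polynomial_eq_zero_of_eval_natCast 1 fun n => (hl n).1,
    polynomial_eq_zero_of_eval_natCast 1 fun n => (hl n).2⟩

end Structure

end ThreeLines

end

noncomputable section

namespace ThreeLines

/-! ### Inner derivations and equality of derivations on generators -/

section Inner

variable {k : Type*} [CommRing k] {A : Type*} [Ring A] [Algebra k A]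

theorem der_mul (d : Der k A) (a b : A) : d.1 (a * b) = d.1 a * b + a * d.1 b := d.2 a b

theorem der_one (d : Der k A) : d.1 1 = 0 := by
  have := der_mul d 1 1
  simpa using this

theorem der_algebraMap (d : Der k A) (c : k) : d.1 (algebraMap k A c) = 0 := by
  rw [Algebra.algebraMap_eq_smul_one, map_smul, der_one, smul_zero]

variable (k) in
/-- The inner derivation `v ↦ u v - v u`. -/
def innerDer (u : A) : Der k A :=
  ⟨LinearMap.mulLeft k u - LinearMap.mulRight k u, fun a b => by
    simp only [LinearMap.sub_apply, LinearMap.mulLeft_apply, LinearMap.mulRight_apply, sub_mul,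
      mul_sub, mul_assoc]
    abel⟩

theorem innerDer_sub (u v : A) : innerDer k (u - v) = innerDer k u - innerDer k v := by
  refine Subtype.ext (LinearMap.ext fun w => ?_)
  change (u - v) * w - w * (u - v) = (u * w - w * u) - (v * w - w * v)
  rw [sub_mul, mul_sub]
  abel

theorem innerDer_mem (u : A) : innerDer k u ∈ Inn k A := ⟨u, fun _ => rfl⟩

/-- The subalgebra of elements on which two derivations agree. -/
def Der.eqLocus (d e : Der k A) : Subalgebra k A where
  carrier := {a | d.1 a = e.1 a}
  mul_mem' := fun {a b} (ha : d.1 a = e.1 a) (hb : d.1 b = e.1 b) => by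
    change d.1 (a * b) = e.1 (a * b)
    rw [der_mul, der_mul, ha, hb]
  add_mem' := fun {a b} (ha : d.1 a = e.1 a) (hb : d.1 b = e.1 b) => by
    change d.1 (a + b) = e.1 (a + b)
    rw [map_add, map_add, ha, hb]
  algebraMap_mem' := fun c => by
    change d.1 _ = e.1 _
    rw [der_algebraMap, der_algebraMap]

end Inner

/-! ### Normal form of a derivation modulo inner derivations -/

section Classification

open MvPolynomial

variable {k : Type*} [Field k] {t : k}

theorem elS_mem (B : Subalgebra k (U t)) (hB : ∀ i, elS t (X i) ∈ B)
    (s : MvPolynomial (Fin 2) k) : elS t s ∈ B := by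
  induction s using MvPolynomial.induction_on with
  | C a => rw [elS_C]; exact B.algebraMap_mem a
  | add p q hp hq => rw [elS_add]; exact add_mem hp hq
  | mul_X p i hp => rw [elS_mul]; exact mul_mem hp (hB i)

/-- `Diff 𝒜` is generated by `x`, `y`, `E` and `D`. -/
theorem eq_top_of_mem [CharZero k] (ht : t ≠ 0) (B : Subalgebra k (U t)) (hB : ∀ i, elS t (X i) ∈ B)
    (hE : elE t ∈ B) (hD : elD t ∈ B) : B = ⊤ := by
  rw [eq_top_iff]
  intro u _
  have hu : u ∈ ⨆ j, weightSpace t j := iSup_weightSpace ht ▸ Submodule.mem_top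
  have hle : ⨆ j, weightSpace t j ≤ Subalgebra.toSubmodule B := by
    refine iSup_le fun j => Submodule.span_le.2 ?_
    rintro _ ⟨a, c, d, s, -, -, rfl⟩
    exact B.mul_mem (B.mul_mem (elS_mem B hB s) (pow_mem hD c)) (pow_mem hE d)
  exact hle hu

theorem Der.ext_of_generators [CharZero k] (ht : t ≠ 0) {d e : Der k (U t)}
    (h : ∀ i, d.1 (elS t (X i)) = e.1 (elS t (X i))) (hE : d.1 (elE t) = e.1 (elE t))
    (hD : d.1 (elD t) = e.1 (elD t)) : d = e := by
  have hB := eq_top_of_mem ht (Der.eqLocus d e) h hE hD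
  refine Subtype.ext (LinearMap.ext fun u => ?_)
  have : u ∈ Der.eqLocus d e := hB ▸ Algebra.mem_top
  exact this

theorem polynomial_eq_C_of_comp_eq [CharZero k] {p : Polynomial k}
    (h : p.comp (Polynomial.X + 1) - p = 0) : ∃ a, p = Polynomial.C a := by
  refine ⟨p.eval 0, sub_eq_zero.1 (polynomial_eq_zero_of_eval_natCast 0 fun n => ?_)⟩
  induction n with
  | zero => simp
  | succ n ih =>
    have h1 := congrArg (Polynomial.eval (n : k)) h
    simp [sub_eq_zero] at h1 ih ⊢
    rw [h1, ih]

theorem polynomial_eq_zero_of_comp_eq_zero [CharZero k] {p : Polynomial k}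
    (h : p.comp (Polynomial.X + 1) = 0) : p = 0 := by
  refine polynomial_eq_zero_of_eval_natCast 1 fun n => ?_
  have h1 := congrArg (Polynomial.eval (n : k)) h
  simpa using h1

theorem elD_mul_X_zero : elD t * elS t (X 0) = elS t (X 0) * elD t := by
  rw [elD_mul_elS, derD_X_zero, elS_zero, add_zero]

theorem elS_X_one_mul_X_zero : elS t (X 1) * elS t (X 0) = elS t (X 0) * elS t (X 1) := by
  rw [← elS_mul, ← elS_mul, mul_comm]

theorem elD_mul_X_one : elD t * elS t (X 1) = elS t (X 1) * elD t +
    t • (elS t (X 0) * elS t (X 1)) + elS t (X 1) * elS t (X 1) := by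
  have : polyF t = t • (X 0 * X 1) + X 1 * X 1 := by
    rw [polyF, smul_eq_C_mul]; ring
  rw [elD_mul_elS, derD_X_one, this, elS_add, elS_smul, elS_mul, elS_mul, add_assoc]

/-- The values on `x`, `y` and `D` of a derivation compatible with the relations between `x`, `y`,
`D` and `E`, when they have weight one and the value on `x` is in `y k[E] + D k[E]`. -/
theorem eq_zero_of_relations [CharZero k] (ht : t ≠ 0) {A : Type*} [Ring A] [Algebra k A]
    {x y D dx dy dD : A} {ev : Polynomial k →ₐ[k] A}
    (sx : ∀ p, ev p * x = x * ev (p.comp (Polynomial.X + 1)))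
    (sy : ∀ p, ev p * y = y * ev (p.comp (Polynomial.X + 1)))
    (sD : ∀ p, ev p * D = D * ev (p.comp (Polynomial.X + 1)))
    (cyx : y * x = x * y) (cDx : D * x = x * D) (cDy : D * y = y * D + t • (x * y) + y * y)
    (ind : ∀ p₁ p₂ p₃ p₄ p₅, x * (x * ev p₁) + x * (y * ev p₂) + y * (y * ev p₃) +
      x * (D * ev p₄) + y * (D * ev p₅) = 0 → p₁ = 0 ∧ p₂ = 0 ∧ p₃ = 0 ∧ p₄ = 0 ∧ p₅ = 0)
    {b c p q r u v w : Polynomial k} (hx : dx = y * ev b + D * ev c)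
    (hy : dy = x * ev p + y * ev q + D * ev r) (hD : dD = x * ev u + y * ev v + D * ev w)
    (r1 : dy * x + y * dx = dx * y + x * dy) (r2 : dD * x + D * dx = dx * D + x * dD)
    (r3 : dD * y + D * dy = dy * D + y * dD + t • (dx * y + x * dy) + (dy * y + y * dy)) :
    dx = 0 ∧ dy = 0 ∧ ∃ α β : k, dD = α • x + β • y := by
  have tx : ∀ s, y * (x * s) = x * (y * s) := fun s => by rw [← mul_assoc, cyx, mul_assoc]
  have tDx : ∀ s, D * (x * s) = x * (D * s) := fun s => by rw [← mul_assoc, cDx, mul_assoc]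
  have tDy : ∀ s, D * (y * s) = y * (D * s) + t • (x * (y * s)) + y * (y * s) := fun s => by
    rw [← mul_assoc, cDy]
    simp only [add_mul, smul_mul_assoc, mul_assoc]
  rw [hx, hy] at r1
  rw [hx, hD] at r2
  -- The arguments of `ind` are the coefficients of `x²`, `xy`, `y²`, `xD`, `yD` in a relation once
  -- every polynomial in `E` has been moved to the right.
  obtain ⟨e1, e2, e3, e4, e5⟩ := ind (p.comp (Polynomial.X + 1) - p)
    (q.comp (Polynomial.X + 1) - q - t • c.comp (Polynomial.X + 1))
    (-(b.comp (Polynomial.X + 1) - b) - c.comp (Polynomial.X + 1))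
    (r.comp (Polynomial.X + 1) - r) (-(c.comp (Polynomial.X + 1) - c)) (by
      simp only [mul_add, add_mul, mul_assoc, sx, sy, tx, tDx, tDy] at r1
      rw [← sub_eq_zero] at r1
      rw [← r1]
      simp only [map_sub, map_neg, map_smul, mul_sub, mul_neg, mul_smul_comm]
      module)
  -- This cancels the `D²` terms of `r2`, which `ind` does not cover.
  have e5' : c.comp (Polynomial.X + 1) = c := sub_eq_zero.1 (neg_eq_zero.1 e5)
  obtain ⟨f1, f2, f3, f4, -⟩ := ind (u.comp (Polynomial.X + 1) - u)
    (v.comp (Polynomial.X + 1) - v + t • b) b (w.comp (Polynomial.X + 1) - w)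
    (b - b.comp (Polynomial.X + 1)) (by
      simp only [mul_add, add_mul, mul_assoc, sx, sD, tx, tDx, tDy, e5'] at r2
      rw [← sub_eq_zero] at r2
      rw [← r2]
      simp only [map_sub, map_add, map_smul, mul_sub, mul_add, mul_smul_comm]
      module)
  -- The `y²` coefficient of `r2` is `b`; with `b = 0`, `e3` says that the shift of `c` vanishes.
  subst f3
  have hc : c = 0 := by
    refine polynomial_eq_zero_of_comp_eq_zero ?_
    simpa using e3
  subst hc
  have hx0 : dx = 0 := by simp [hx]
  rw [Polynomial.zero_comp, smul_zero, sub_zero] at e2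
  rw [smul_zero, add_zero] at f2
  obtain ⟨p, rfl⟩ := polynomial_eq_C_of_comp_eq e1
  obtain ⟨q, rfl⟩ := polynomial_eq_C_of_comp_eq e2
  obtain ⟨r, rfl⟩ := polynomial_eq_C_of_comp_eq e4
  obtain ⟨u, rfl⟩ := polynomial_eq_C_of_comp_eq f1
  obtain ⟨v, rfl⟩ := polynomial_eq_C_of_comp_eq f2
  obtain ⟨w, rfl⟩ := polynomial_eq_C_of_comp_eq f4
  have hev : ∀ a, ev (Polynomial.C a) = algebraMap k A a := fun a => ev.commutes a
  simp only [hev, ← Algebra.commutes, ← Algebra.smul_def] at hy hD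
  rw [hx0, hy, hD] at r3
  -- All coefficients are now constants. The third relation kills `p`, `q`, `r`, `w`, using `t ≠ 0`;
  -- `u` and `v` cancel from it and stay free.
  obtain ⟨g1, g2, g3, g4, -⟩ := ind (Polynomial.C (-t * p))
    (Polynomial.C (t * w - 2 * p - t * r)) (Polynomial.C (w - q - r)) (Polynomial.C (-t * r))
    (Polynomial.C (-2 * r)) (by
      simp only [mul_add, add_mul, cyx, cDx, cDy, smul_mul_assoc, mul_smul_comm, zero_mul] at r3
      rw [← sub_eq_zero] at r3
      rw [← r3]
      simp only [hev, ← Algebra.commutes, ← Algebra.smul_def]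
      simp only [mul_smul_comm]
      module)
  rw [Polynomial.C_eq_zero] at g1 g2 g3 g4
  have hp : p = 0 := by simpa [ht] using g1
  have hr : r = 0 := by simpa [ht] using g4
  have hw : w = 0 := by simpa [hp, hr, ht] using g2
  have hq : q = 0 := by simpa [hr, hw] using g3
  exact ⟨hx0, by simp [hy, hp, hq, hr], u, v, by simp [hD, hw]⟩

set_option maxHeartbeats 1000000 in
/-- Up to inner derivations, a derivation of `Diff 𝒜` has weight zero and maps `E` to a scalar. -/
theorem Der.exists_add_innerDer [CharZero k] (ht : t ≠ 0) (d : Der k (U t)) :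
    ∃ (u : U t) (c : k) (d₁ : Der k (U t)), d₁ = d + innerDer k u ∧
      d₁.1 (elE t) = algebraMap k (U t) c ∧ (∀ i, d₁.1 (elS t (X i)) ∈ weightSpace t 1) ∧
      d₁.1 (elD t) ∈ weightSpace t 1 := by
  have hW := adE_of_mem_weightSpace (t := t)
  have hT := iSup_weightSpace ht
  obtain ⟨e, he, u, hu⟩ := exists_eq_add_apply hW hT (d.1 (elE t))
  have hE : (d + innerDer k u).1 (elE t) = e := by
    change d.1 (elE t) + (u * elE t - elE t * u) = e
    rw [hu, adE_apply]
    abel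
  obtain ⟨d₁, hd₁⟩ : ∃ d₁, d₁ = d + innerDer k u := ⟨_, rfl⟩
  rw [← hd₁] at hE
  have heE : adE t e = 0 := by
    rw [hW 0 e he, Nat.cast_zero, zero_smul]
  -- Applying `d₁` to `[E, v] = v` gives `[E, d₁ v] = d₁ v - [e, v]`, where `[e, v]` has weight one
  -- because `e` has weight zero.
  have key : ∀ v : U t, adE t v = v → e * v - v * e = 0 ∧ d₁.1 v ∈ weightSpace t 1 := by
    intro v hv
    refine eq_zero_and_mem_of_apply_eq_sub (n := 1) hW hT ?_ ?_
    · rw [map_sub, adE_mul, adE_mul, heE, hv, zero_mul, mul_zero, zero_add, add_zero,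
        Nat.cast_one, one_smul]
    · have := congrArg d₁.1 hv
      rw [adE_apply, map_sub, der_mul, der_mul, hE] at this
      rw [Nat.cast_one, one_smul]
      nth_rewrite 2 [← this]
      rw [adE_apply]
      abel
  have hX : ∀ i, adE t (elS t (X i)) = elS t (X i) := fun i => by
    rw [adE_elS (isHomogeneous_X k i), Nat.cast_one, one_smul]
  have hD : adE t (elD t) = elD t := by
    have := adE_elD_pow (t := t) 1
    rwa [Nat.cast_one, one_smul, pow_one] at this
  -- Commuting with `x` and `y`, `e` is a polynomial; being of weight zero, it is constant.
  have heS : e = elS t (e.1 1) := by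
    apply Subtype.ext
    exact eq_mulOp_of_adMul_eq_zero (congrArg Subtype.val (key _ (hX 0)).1)
      (congrArg Subtype.val (key _ (hX 1)).1)
  obtain ⟨c, hc⟩ : ∃ c, e = algebraMap k (U t) c := by
    rw [heS, adE_apply, elE_mul_elS, add_sub_cancel_left, ← elS_zero] at heE
    obtain ⟨-, a, ha⟩ := eq_C_of_derE_eq_C (c := 0) ((elS_injective heE).trans (map_zero C).symm)
    exact ⟨a, by rw [heS, ha, elS_C]⟩
  exact ⟨u, c, d₁, hd₁, hE.trans hc, fun i => (key _ (hX i)).2, (key _ hD).2⟩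

set_option maxHeartbeats 1000000 in
/-- Every derivation of `Diff 𝒜` is, up to inner derivations, one which kills `x` and `y` and maps
`E` to a scalar and `D` to a linear form. -/
theorem Der.exists_innerDer_add [CharZero k] (ht : t ≠ 0) (d : Der k (U t)) :
    ∃ (u : U t) (d' : Der k (U t)) (c α β : k), d = innerDer k u + d' ∧
      (∀ i, d'.1 (elS t (X i)) = 0) ∧ d'.1 (elE t) = algebraMap k (U t) c ∧
      d'.1 (elD t) = elS t (α • X 0 + β • X 1) := by
  obtain ⟨u, c, d₁, hd₁, hE, hX, hD⟩ := Der.exists_add_innerDer ht d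
  obtain ⟨a, b, c', hx⟩ := exists_of_mem_weightSpace_one (hX 0)
  obtain ⟨p, q, r, hy⟩ := exists_of_mem_weightSpace_one (hX 1)
  obtain ⟨u', v', w', hDD⟩ := exists_of_mem_weightSpace_one hD
  -- The inner derivation of `g(E)` multiplies each of `x`, `y`, `D` by `a(E)` on the right.
  -- Subtracting it removes `x a(E)` from the value at `x`, at the price of the shifts `q - a` and
  -- `w' - a` below.
  obtain ⟨g, hg⟩ := exists_comp_sub_eq a
  have sx := fun p : Polynomial k => aeval_mul_of_shift (elE_mul_X (t := t) 0) p
  have sy := fun p : Polynomial k => aeval_mul_of_shift (elE_mul_X (t := t) 1) p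
  have sD := fun p : Polynomial k => aeval_mul_of_shift (elE_mul_elD (t := t)) p
  obtain ⟨d₂, hd₂⟩ : ∃ d₂, d₂ = d₁ - innerDer k (Polynomial.aeval (elE t) g) := ⟨_, rfl⟩
  have hd₂app : ∀ v, d₂.1 v = d₁.1 v -
      (Polynomial.aeval (elE t) g * v - v * Polynomial.aeval (elE t) g) := fun _ => by
    rw [hd₂]; rfl
  have r1 := congrArg d₂.1 (elS_X_one_mul_X_zero (t := t))
  have r2 := congrArg d₂.1 (elD_mul_X_zero (t := t))
  have r3 := congrArg d₂.1 (elD_mul_X_one (t := t))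
  simp only [map_add, map_smul, der_mul] at r1 r2 r3
  obtain ⟨h0, h1, α, β, h2⟩ := eq_zero_of_relations ht sx sy sD elS_X_one_mul_X_zero
    elD_mul_X_zero elD_mul_X_one (fun _ _ _ _ _ h => eq_zero_of_sum_eq_zero h)
    (b := b) (c := c') (p := p) (q := q - a) (r := r) (u := u') (v := v') (w := w' - a)
    (by rw [hd₂app, hx, sx, ← mul_sub, ← map_sub, hg]; abel)
    (by rw [hd₂app, hy, sy, ← mul_sub, ← map_sub, hg, map_sub, mul_sub]; abel)
    (by rw [hd₂app, hDD, sD, ← mul_sub, ← map_sub, hg, map_sub, mul_sub]; abel) r1 r2 r3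
  refine ⟨Polynomial.aeval (elE t) g - u, d₂, c, α, β, ?_, ?_, ?_, ?_⟩
  · rw [innerDer_sub, hd₂, hd₁]
    abel
  · intro i
    fin_cases i
    · exact h0
    · exact h1
  · have hcomm : Commute (Polynomial.aeval (elE t) g) (elE t) := by
      have := Polynomial.aeval_X (R := k) (elE t)
      nth_rewrite 2 [← this]
      exact Commute.map (Commute.all g Polynomial.X) _
    rw [hd₂app, hE, hcomm.eq, sub_self, sub_zero]
  · rw [h2, elS_add, elS_smul, elS_smul]

end Classification

end ThreeLines

end

noncomputable section

namespace ThreeLines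

/-! ### Bases and commutativity of `Out` from representatives -/

section OutMk

variable {k : Type*} [CommRing k] {A : Type*} [Ring A] [Algebra k A]

variable (k A) in
/-- The class of a derivation in `Out`, as a linear map. -/
def Out.mkₗ : Der k A →ₗ[k] Out k A := (Inn k A).toSubmodule.mkQ

theorem Out.mkₗ_eq_zero {d : Der k A} : Out.mkₗ k A d = 0 ↔ d ∈ Inn k A :=
  Submodule.Quotient.mk_eq_zero _

theorem Out.mkₗ_surjective : Function.Surjective (Out.mkₗ k A) := Submodule.mkQ_surjective _

theorem Out.mkₗ_lie (d e : Der k A) : Out.mkₗ k A ⁅d, e⁆ = ⁅Out.mkₗ k A d, Out.mkₗ k A e⁆ := rfl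

/-- A linear combination of derivations. -/
def Der.comb {ι : Type*} [Fintype ι] (d : ι → Der k A) (c : ι → k) : Der k A := ∑ i, c i • d i

theorem Der.comb_apply {ι : Type*} [Fintype ι] (d : ι → Der k A) (c : ι → k) (v : A) :
    (Der.comb d c).1 v = ∑ i, c i • (d i).1 v := by
  have : (Der.comb d c).1 = ∑ i, c i • (d i).1 := by
    rw [Der.comb]
    exact map_sum (Der k A).toSubmodule.subtype _ _
  rw [this, LinearMap.sum_apply]
  rfl

theorem Out.mkₗ_comb {ι : Type*} [Fintype ι] (d : ι → Der k A) (c : ι → k) :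
    Out.mkₗ k A (Der.comb d c) = ∑ i, c i • Out.mk k A (d i) := by
  rw [Der.comb, map_sum]
  exact Finset.sum_congr rfl fun i _ => map_smul _ _ _

theorem Out.linearIndependent_mk {ι : Type*} [Fintype ι] {d : ι → Der k A}
    (h : ∀ (c : ι → k) (u : A), (∀ v, ∑ i, c i • (d i).1 v = u * v - v * u) → ∀ i, c i = 0) :
    LinearIndependent k fun i => Out.mk k A (d i) := by
  rw [Fintype.linearIndependent_iff]
  intro c hc
  rw [← Out.mkₗ_comb, Out.mkₗ_eq_zero] at hc
  obtain ⟨u, hu⟩ := hc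
  exact h c u fun v => by rw [← Der.comb_apply, hu]

theorem Out.span_mk_eq_top {ι : Type*} [Fintype ι] {d : ι → Der k A}
    (h : ∀ e : Der k A, ∃ (c : ι → k) (u : A), e = innerDer k u + Der.comb d c) :
    Submodule.span k (Set.range fun i => Out.mk k A (d i)) = ⊤ := by
  rw [eq_top_iff]
  intro v _
  obtain ⟨e, rfl⟩ := Out.mkₗ_surjective v
  obtain ⟨c, u, rfl⟩ := h e
  rw [map_add, Out.mkₗ_eq_zero.2 (innerDer_mem u), zero_add, Out.mkₗ_comb]
  exact sum_mem fun i _ => Submodule.smul_mem _ _ (Submodule.subset_span ⟨i, rfl⟩)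

theorem Out.isLieAbelian_of_span {ι : Type*} {d : ι → Der k A}
    (hspan : Submodule.span k (Set.range fun i => Out.mk k A (d i)) = ⊤)
    (hd : ∀ i j u, (d i).1 ((d j).1 u) = (d j).1 ((d i).1 u)) : IsLieAbelian (Out k A) := by
  have hlie : ∀ i j, ⁅d i, d j⁆ = 0 := fun i j => by
    refine Subtype.ext (LinearMap.ext fun u => ?_)
    change (d i).1 ((d j).1 u) - (d j).1 ((d i).1 u) = 0
    rw [hd, sub_self]
  refine ⟨fun v w => ?_⟩
  have hv : v ∈ Submodule.span k (Set.range fun i => Out.mk k A (d i)) :=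
    hspan ▸ Submodule.mem_top
  have hw : w ∈ Submodule.span k (Set.range fun i => Out.mk k A (d i)) :=
    hspan ▸ Submodule.mem_top
  induction hv using Submodule.span_induction with
  | mem v hv =>
    obtain ⟨i, rfl⟩ := hv
    induction hw using Submodule.span_induction with
    | mem w hw =>
      obtain ⟨j, rfl⟩ := hw
      change ⁅Out.mkₗ k A (d i), Out.mkₗ k A (d j)⁆ = 0
      rw [← Out.mkₗ_lie, hlie, map_zero]
    | zero => rw [lie_zero]
    | add v w _ _ hv hw => rw [lie_add, hv, hw, add_zero]
    | smul c v _ hv => rw [lie_smul, hv, smul_zero]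
  | zero => rw [zero_lie]
  | add v w _ _ hv hw => rw [add_lie, hv, hw, add_zero]
  | smul c v _ hv => rw [smul_lie, hv, smul_zero]

/-- The subalgebra of elements on which two derivations commute. -/
def Der.commLocus (d e : Der k A) : Subalgebra k A := Der.eqLocus ⁅d, e⁆ 0

theorem Der.mem_commLocus {d e : Der k A} {u : A} :
    u ∈ Der.commLocus d e ↔ d.1 (e.1 u) = e.1 (d.1 u) :=
  (sub_eq_zero (a := d.1 (e.1 u)) (b := e.1 (d.1 u)))

end OutMk

/-! ### The derivations `∂_f` and the basis they give -/

section Partial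

open MvPolynomial

variable {k : Type*} [Field k] {t : k}

/-- The polynomial `p` interpolates the conjugates `f⁻ⁿ P fⁿ` of `P`. -/
def IsConj (f : MvPolynomial (Fin 2) k) (P : U t) (p : Polynomial (U t)) : Prop :=
  ∀ n : ℕ, P * elS t f ^ n = elS t f ^ n * p.eval (n : U t)

variable {f g : MvPolynomial (Fin 2) k} {P R : U t} {p q : Polynomial (U t)}

/-- Evaluation is multiplicative here, although `U` is not commutative, because `n` is central. -/
theorem eval_natCast_mul (p q : Polynomial (U t)) (n : ℕ) :
    (p * q).eval (n : U t) = p.eval (n : U t) * q.eval (n : U t) :=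
  Polynomial.eval₂_mul_noncomm _ _ fun _ => (Nat.cast_commute n _).symm

theorem IsConj.add (hP : IsConj f P p) (hR : IsConj f R q) : IsConj f (P + R) (p + q) := fun n => by
  rw [add_mul, hP n, hR n, Polynomial.eval_add, mul_add]

theorem IsConj.mul (hP : IsConj f P p) (hR : IsConj f R q) : IsConj f (P * R) (p * q) := fun n => by
  rw [mul_assoc, hR n, ← mul_assoc, hP n, eval_natCast_mul, mul_assoc]

theorem isConj_elS (f s : MvPolynomial (Fin 2) k) :
    IsConj f (elS t s) (Polynomial.C (elS t s)) := fun n => by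
  rw [Polynomial.eval_C, ← elS_pow, ← elS_mul, ← elS_mul, mul_comm]

theorem isConj_algebraMap (f : MvPolynomial (Fin 2) k) (c : k) :
    IsConj f (algebraMap k (U t) c) (Polynomial.C (algebraMap k (U t) c)) := by
  rw [← elS_C]
  exact isConj_elS f _

theorem derivation_pow_of_eq (θ : Derivation k (MvPolynomial (Fin 2) k) (MvPolynomial (Fin 2) k))
    (h : θ f = f * g) (n : ℕ) : θ (f ^ n) = f ^ n * (g * n) := by
  induction n with
  | zero => simp
  | succ n ih =>
    rw [pow_succ, Derivation.leibniz, ih, h, smul_eq_mul, smul_eq_mul]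
    push_cast
    ring

theorem elS_natCast (n : ℕ) : elS t (n : MvPolynomial (Fin 2) k) = n := by
  have := elS_C (t := t) (n : k)
  rwa [map_natCast, map_natCast] at this

theorem isConj_elE (h : derE k f = f) : IsConj f (elE t) (Polynomial.C (elE t) + Polynomial.X) :=
  fun n => by
  rw [← elS_pow, elE_mul_elS, derivation_pow_of_eq _ (h.trans (mul_one f).symm), elS_mul, one_mul,
    Polynomial.eval_add, Polynomial.eval_C, Polynomial.eval_X, mul_add, elS_natCast]

theorem isConj_elD (h : f * g = polyF t * pderiv 1 f) :
    IsConj f (elD t) (Polynomial.C (elD t) + Polynomial.C (elS t g) * Polynomial.X) := fun n => by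
  have h1 : derD t f = f * g := h.symm
  rw [← elS_pow, elD_mul_elS, derivation_pow_of_eq _ h1, elS_mul, elS_mul,
    Polynomial.eval_add, Polynomial.eval_C, eval_natCast_mul, Polynomial.eval_C, Polynomial.eval_X,
    mul_add, elS_natCast]

/-- Applying the coefficients to a fixed `s` turns `p` and `q` into polynomials over the domain `S`,
which agree at all naturals after cancelling `fⁿ`. -/
theorem IsConj.unique [CharZero k] (hf : f ≠ 0) (hp : IsConj f P p) (hq : IsConj f P q) :
    p = q := by
  ext i : 1
  apply Subtype.ext
  refine LinearMap.ext fun s => ?_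
  set φ : Polynomial (U t) → Polynomial (MvPolynomial (Fin 2) k) := fun r =>
    ∑ i ∈ Finset.range (p.natDegree + q.natDegree + 1), Polynomial.monomial i ((r.coeff i).1 s)
    with hφ
  have hev : ∀ (r : Polynomial (U t)), r.natDegree < p.natDegree + q.natDegree + 1 → ∀ n : ℕ,
      (φ r).eval (n : MvPolynomial (Fin 2) k) = (r.eval (n : U t)).1 s := by
    intro r hr n
    rw [Polynomial.eval_eq_sum_range' hr, hφ, Polynomial.eval_finsetSum,
      AddSubmonoidClass.coe_finsetSum, LinearMap.sum_apply]
    refine Finset.sum_congr rfl fun j _ => ?_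
    rw [Polynomial.eval_monomial, ← Nat.cast_pow, ← Nat.cast_pow, mul_comm, ← nsmul_eq_mul]
    have : r.coeff j * ((n ^ j : ℕ) : U t) = (n ^ j) • r.coeff j := by
      rw [nsmul_eq_mul, Nat.cast_comm]
    rw [this]
    rfl
  have heq : φ p = φ q := by
    refine Polynomial.eq_of_infinite_eval_eq _ _
      ((Set.infinite_range_of_injective
        (Nat.cast_injective (R := MvPolynomial (Fin 2) k))).mono ?_)
    rintro _ ⟨n, rfl⟩
    change (φ p).eval _ = (φ q).eval _
    rw [hev p (by omega), hev q (by omega)]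
    have h1 := (hp n).symm.trans (hq n)
    rw [← elS_pow] at h1
    exact mul_left_cancel₀ (pow_ne_zero n hf) (LinearMap.congr_fun (congrArg Subtype.val h1) s)
  have hco : ∀ (r : Polynomial (U t)), r.natDegree < p.natDegree + q.natDegree + 1 →
      (φ r).coeff i = (r.coeff i).1 s := by
    intro r hr
    simp only [hφ, Polynomial.finsetSum_coeff, Polynomial.coeff_monomial]
    rw [Finset.sum_ite_eq' _ i]
    split_ifs with h
    · rfl
    · rw [Polynomial.coeff_eq_zero_of_natDegree_lt (by simp at h; omega)]
      rfl
  rw [← hco p (by omega), ← hco q (by omega), heq]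

/-- The operators admitting an interpolating polynomial form a subalgebra, so the generators
suffice; for them the polynomial has degree at most one. -/
theorem exists_isConj [CharZero k] (ht : t ≠ 0) (hE : derE k f = f)
    (hD : f * g = polyF t * pderiv 1 f) (P : U t) : ∃ p, IsConj f P p := by
  let B : Subalgebra k (U t) :=
    { carrier := {P | ∃ p, IsConj f P p}
      mul_mem' := fun ⟨p, hp⟩ ⟨q, hq⟩ => ⟨p * q, hp.mul hq⟩
      add_mem' := fun ⟨p, hp⟩ ⟨q, hq⟩ => ⟨p + q, hp.add hq⟩
      algebraMap_mem' := fun c => ⟨_, isConj_algebraMap f c⟩ }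
  have hB : B = ⊤ := eq_top_of_mem ht B (fun i => ⟨_, isConj_elS f _⟩) ⟨_, isConj_elE hE⟩
    ⟨_, isConj_elD hD⟩
  have : P ∈ B := hB ▸ Algebra.mem_top
  exact this

/-- The derivation `P ↦ [P, log f]`: its value at `P` is the coefficient of `n` in `f⁻ⁿ P fⁿ`. -/
theorem exists_der [CharZero k] (ht : t ≠ 0) (hf : f ≠ 0) (hE : derE k f = f)
    (hD : f * g = polyF t * pderiv 1 f) : ∃ d : Der k (U t),
      (∀ s, d.1 (elS t s) = 0) ∧ d.1 (elD t) = elS t g ∧ d.1 (elE t) = 1 := by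
  choose φ hφ using exists_isConj ht hE hD
  have hc : ∀ {P : U t} {p}, IsConj f P p → φ P = p := fun h => (hφ _).unique hf h
  have h0 : ∀ P, (φ P).coeff 0 = P := fun P => by
    have := hφ P 0
    rw [pow_zero, mul_one, one_mul, Nat.cast_zero] at this
    rw [Polynomial.coeff_zero_eq_eval_zero]
    exact this.symm
  let δ : U t →ₗ[k] U t :=
    { toFun := fun P => (φ P).coeff 1
      map_add' := fun P R => by rw [hc ((hφ P).add (hφ R)), Polynomial.coeff_add]
      map_smul' := fun c P => by
        rw [Algebra.smul_def, hc ((isConj_algebraMap f c).mul (hφ P)), Polynomial.coeff_C_mul,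
          RingHom.id_apply, Algebra.smul_def] }
  refine ⟨⟨δ, fun P R => ?_⟩, fun s => ?_, ?_, ?_⟩
  -- `φ` is multiplicative by uniqueness and `φ P` has constant term `P`, so the linear coefficient
  -- of a product obeys the Leibniz rule.
  · change (φ (P * R)).coeff 1 = (φ P).coeff 1 * R + P * (φ R).coeff 1
    rw [hc ((hφ P).mul (hφ R)), Polynomial.mul_coeff_one, h0, h0, add_comm]
  · change (φ _).coeff 1 = 0
    rw [hc (isConj_elS f s), Polynomial.coeff_C_of_ne_zero one_ne_zero]
  · change (φ _).coeff 1 = _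
    rw [hc (isConj_elD hD), Polynomial.coeff_add, Polynomial.coeff_C_of_ne_zero one_ne_zero,
      Polynomial.coeff_C_mul, Polynomial.coeff_X_one, mul_one, zero_add]
  · change (φ _).coeff 1 = _
    rw [hc (isConj_elE hE), Polynomial.coeff_add, Polynomial.coeff_C_of_ne_zero one_ne_zero,
      Polynomial.coeff_X_one, zero_add]

/-- The quotient `(F / f) ∂f/∂y` for the three linear forms `f`. -/
def cofactor (t : k) : Fin 3 → MvPolynomial (Fin 2) k := ![0, C t * X 0 + X 1, X 1]

theorem form_mul_cofactor (i : Fin 3) :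
    form t i * cofactor t i = polyF t * pderiv 1 (form t i) := by
  fin_cases i
  · simp [form, cofactor, pderiv_X]
  · simp [form, cofactor, polyF]
  · simp [form, cofactor, polyF, pderiv_X]
    ring

theorem derE_form (i : Fin 3) : derE k (form t i) = form t i := by
  fin_cases i
  · exact derE_X 0
  · exact derE_X 1
  · change derE k (C t * X 0 + X 1) = C t * X 0 + X 1
    rw [← smul_eq_C_mul, map_add, Derivation.map_smul, derE_X, derE_X]

theorem isPartial_iff {i : Fin 3} {d : Der k (U t)} : IsPartial t (form t i) d ↔
    (∀ j, d.1 (elS t (X j)) = 0) ∧ d.1 (elD t) = elS t (cofactor t i) ∧ d.1 (elE t) = 1 := by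
  rw [Fin.forall_fin_two]
  constructor
  · rintro ⟨h0, h1, ⟨g, hg, hD⟩, hE⟩
    rw [← form_mul_cofactor] at hg
    rw [mul_left_cancel₀ (prime_form t i).ne_zero hg] at hD
    exact ⟨⟨h0, h1⟩, hD, hE⟩
  · rintro ⟨⟨h0, h1⟩, hD, hE⟩
    exact ⟨h0, h1, ⟨_, form_mul_cofactor i, hD⟩, hE⟩

theorem existsUnique_isPartial [CharZero k] (ht : t ≠ 0) (i : Fin 3) :
    ∃! d : Der k (U t), IsPartial t (form t i) d := by
  obtain ⟨d, hS, hD, hE⟩ := exists_der ht (prime_form t i).ne_zero (derE_form i)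
    (form_mul_cofactor i)
  refine ⟨d, isPartial_iff.2 ⟨fun j => hS _, hD, hE⟩, fun e he => ?_⟩
  obtain ⟨hS', hD', hE'⟩ := isPartial_iff.1 he
  exact Der.ext_of_generators ht (fun j => by rw [hS', hS]) (by rw [hE, hE']) (by rw [hD, hD'])

section Basis

variable {d : Fin 3 → Der k (U t)}

/-- If a combination is inner, by `u`, then `u` commutes with `x` and `y`, so it is a polynomial.
The value at `E` makes its Euler derivative a constant, which forces that constant to be zero and
`u` to be a scalar. The combination is therefore zero, and its values at `E` and `D` kill the
coefficients. -/
theorem linearIndependent_mk [CharZero k] (ht : t ≠ 0)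
    (hd : ∀ i, IsPartial t (form t i) (d i)) :
    LinearIndependent k fun i => Out.mk k (U t) (d i) := by
  simp only [isPartial_iff] at hd
  refine Out.linearIndependent_mk fun c u hu => ?_
  simp only [Fin.sum_univ_three] at hu
  have hX : ∀ j, u * elS t (X j) - elS t (X j) * u = 0 := fun j => by
    rw [← hu, (hd 0).1, (hd 1).1, (hd 2).1, smul_zero, smul_zero, smul_zero, add_zero, add_zero]
  have huS : u = elS t (u.1 1) := Subtype.ext (eq_mulOp_of_adMul_eq_zero
    (congrArg Subtype.val (hX 0)) (congrArg Subtype.val (hX 1)))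
  have hE : elS t (derE k (u.1 1)) = elS t (C (-(c 0 + c 1 + c 2))) := by
    have h2 := hu (elE t)
    rw [(hd 0).2.2, (hd 1).2.2, (hd 2).2.2, ← add_smul, ← add_smul,
      ← Algebra.algebraMap_eq_smul_one, ← elS_C, huS, elE_mul_elS, sub_add_cancel_left] at h2
    have h3 : elS t (derE k (u.1 1)) = (-1 : k) • elS t (C (c 0 + c 1 + c 2)) := by
      rw [h2]; simp
    rw [h3, ← elS_smul, map_neg, neg_one_smul]
  obtain ⟨hsum, a, ha⟩ := eq_C_of_derE_eq_C (elS_injective hE)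
  have hD := hu (elD t)
  rw [(hd 0).2.1, (hd 1).2.1, (hd 2).2.1, huS, ha, elS_C, Algebra.commutes,
    sub_self, ← elS_smul, ← elS_smul, ← elS_smul, ← elS_add, ← elS_add, ← elS_zero] at hD
  have hD' := elS_injective hD
  have e1 := congrArg (eval ![1, 0]) hD'
  have e2 := congrArg (eval ![0, 1]) hD'
  simp [cofactor, smul_eval, ht] at e1 e2
  have e3 : c 2 = 0 := by simpa [e1] using e2
  have e4 : c 0 = 0 := by simpa [e1, e3] using hsum
  intro i
  fin_cases i
  · exact e4
  · exact e1
  · exact e3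

theorem span_mk [CharZero k] (ht : t ≠ 0) (hd : ∀ i, IsPartial t (form t i) (d i)) :
    Submodule.span k (Set.range fun i => Out.mk k (U t) (d i)) = ⊤ := by
  simp only [isPartial_iff] at hd
  refine Out.span_mk_eq_top fun e => ?_
  obtain ⟨u, e', c, α, β, rfl, hX, hE, hD⟩ := Der.exists_innerDer_add ht e
  -- The coefficients add up to `c`, the value at `E`, and `α x + β y = (α / t)(t x + y) + (β - α /
  -- t) y` is the value at `D`.
  refine ⟨![c - β, α / t, β - α / t], u, congrArg _ ?_⟩
  refine Der.ext_of_generators ht (fun i => ?_) ?_ ?_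
  · rw [hX, Der.comb_apply, Fin.sum_univ_three, (hd 0).1, (hd 1).1, (hd 2).1, smul_zero,
      smul_zero, smul_zero, add_zero, add_zero]
  · rw [hE, Der.comb_apply, Fin.sum_univ_three, (hd 0).2.2, (hd 1).2.2, (hd 2).2.2, ← add_smul,
      ← add_smul, Algebra.algebraMap_eq_smul_one]
    congr 1
    simp
  · rw [hD, Der.comb_apply, Fin.sum_univ_three, (hd 0).2.1, (hd 1).2.1, (hd 2).2.1, ← elS_smul,
      ← elS_smul, ← elS_smul, ← elS_add, ← elS_add]
    congr 1
    have : (C α : MvPolynomial (Fin 2) k) = C (α / t) * C t := by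
      rw [← C_mul, div_mul_cancel₀ _ ht]
    simp only [cofactor, smul_eq_C_mul, this, Matrix.cons_val, C_sub]
    ring

/-- Each `∂_f` kills `S` and sends `D` and `E` into `S`, so both composites vanish on all
generators. -/
theorem isPartial_comm [CharZero k] (ht : t ≠ 0) (hd : ∀ i, IsPartial t (form t i) (d i))
    (i j : Fin 3) (u : U t) : (d i).1 ((d j).1 u) = (d j).1 ((d i).1 u) := by
  simp only [isPartial_iff] at hd
  have hS : ∀ i s, (d i).1 (elS t s) = 0 := fun i s =>
    elS_mem (Der.eqLocus (d i) 0) (fun l => (hd i).1 l) s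
  have h : Der.commLocus (d i) (d j) = ⊤ := by
    refine eq_top_of_mem ht _ (fun l => ?_) ?_ ?_
    · rw [Der.mem_commLocus, hS, hS, map_zero, map_zero]
    · rw [Der.mem_commLocus, (hd i).2.2, (hd j).2.2, der_one, der_one]
    · rw [Der.mem_commLocus, (hd i).2.1, (hd j).2.1, hS, hS]
  exact Der.mem_commLocus.1 (h ▸ Algebra.mem_top)

end Basis

theorem isLieAbelian_out_and_finrank [CharZero k] (ht : t ≠ 0) :
    IsLieAbelian (Out k (U t)) ∧ Module.finrank k (Out k (U t)) = 3 := by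
  choose d hd _ using existsUnique_isPartial ht
  refine ⟨Out.isLieAbelian_of_span (span_mk ht hd) (isPartial_comm ht hd), ?_⟩
  rw [Module.finrank_eq_card_basis
    (Module.Basis.mk (linearIndependent_mk ht hd) (span_mk ht hd).ge), Fintype.card_fin]

end Partial

end ThreeLines

end

noncomputable section

namespace ThreeLines

/-! ### Invariance of `Out` under isomorphism, and `HH¹ = Out` -/

section Transport

variable {k : Type*} [CommRing k]

/-- An isomorphism of Lie algebras matching two ideals induces one of the quotients. -/
def quotientLieEquiv {L L' : Type*} [LieRing L] [LieAlgebra k L] [LieRing L'] [LieAlgebra k L']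
    (φ : L ≃ₗ⁅k⁆ L') (I : LieIdeal k L) (I' : LieIdeal k L') (h : ∀ x, x ∈ I ↔ φ x ∈ I') :
    (L ⧸ I) ≃ₗ⁅k⁆ (L' ⧸ I') :=
  { Submodule.Quotient.equiv I.toSubmodule I'.toSubmodule φ.toLinearEquiv (by
      ext y
      constructor
      · rintro ⟨x, hx, rfl⟩
        exact (h x).1 hx
      · intro hy
        refine ⟨φ.symm y, (h _).2 ?_, φ.apply_symm_apply y⟩
        rw [φ.apply_symm_apply]
        exact hy) with
    map_lie' := by
      rintro ⟨x⟩ ⟨y⟩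
      change LieSubmodule.Quotient.mk (N := I') (φ ⁅x, y⁆) = _
      rw [LieEquiv.map_lie]
      rfl }

variable {A B : Type*} [Ring A] [Algebra k A] [Ring B] [Algebra k B]

/-- Transport of a derivation along an isomorphism of algebras. -/
def Der.map (e : A ≃ₐ[k] B) (d : Der k A) : Der k B :=
  ⟨e.toLinearMap ∘ₗ d.1 ∘ₗ e.symm.toLinearMap, fun a b => by
    simp [der_mul]⟩

/-- Isomorphic algebras have isomorphic Lie algebras of derivations. -/
def derLieEquiv (e : A ≃ₐ[k] B) : Der k A ≃ₗ⁅k⁆ Der k B where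
  toFun := Der.map e
  invFun := Der.map e.symm
  map_add' d d' := Subtype.ext (LinearMap.ext fun b => map_add e _ _)
  map_smul' c d := Subtype.ext (LinearMap.ext fun b => map_smul e c _)
  map_lie' {d d'} := Subtype.ext (LinearMap.ext fun b => by
    change e (d.1 (d'.1 (e.symm b)) - d'.1 (d.1 (e.symm b))) =
      e (d.1 (e.symm (e (d'.1 (e.symm b))))) - e (d'.1 (e.symm (e (d.1 (e.symm b)))))
    simp)
  left_inv d := Subtype.ext (LinearMap.ext fun a => by
    change e.symm (e (d.1 (e.symm (e a)))) = d.1 a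
    simp)
  right_inv d := Subtype.ext (LinearMap.ext fun b => by
    change e (e.symm (d.1 (e (e.symm b)))) = d.1 b
    simp)

/-- Isomorphic algebras have isomorphic Lie algebras of outer derivations. -/
def outLieEquiv (e : A ≃ₐ[k] B) : Out k A ≃ₗ⁅k⁆ Out k B :=
  quotientLieEquiv (derLieEquiv e) _ _ fun d => by
    constructor
    · rintro ⟨u, hu⟩
      refine ⟨e u, fun v => ?_⟩
      change e (d.1 (e.symm v)) = _
      rw [hu]
      simp
    · rintro ⟨u, hu⟩
      refine ⟨e.symm u, fun v => e.injective ?_⟩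
      have := hu (e v)
      change e (d.1 (e.symm (e v))) = _ at this
      rw [e.symm_apply_apply] at this
      rw [this]
      simp

theorem isLieAbelian_out_and_finrank_of_algEquiv (e : A ≃ₐ[k] B) {n : ℕ}
    (h : IsLieAbelian (Out k A) ∧ Module.finrank k (Out k A) = n) :
    IsLieAbelian (Out k B) ∧ Module.finrank k (Out k B) = n :=
  ⟨(lie_abelian_iff_equiv_lie_abelian (outLieEquiv e)).1 h.1,
    (outLieEquiv e).toLinearEquiv.finrank_eq.symm.trans h.2⟩

variable (k A) in
/-- The 1-cocycles are the derivations. -/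
def cocycleLieEquiv : hochschildZ1 k A ≃ₗ⁅k⁆ Der k A where
  toFun f := ⟨f.1, (mem_ker_hochschildD1 k A f.1).1 f.2⟩
  invFun d := ⟨d.1, (mem_ker_hochschildD1 k A d.1).2 d.2⟩
  map_add' _ _ := rfl
  map_smul' _ _ := rfl
  map_lie' := rfl
  left_inv _ := rfl
  right_inv _ := rfl

theorem mem_hochschildB1_iff (f : hochschildZ1 k A) :
    f ∈ hochschildB1 k A ↔ cocycleLieEquiv k A f ∈ Inn k A := by
  constructor
  · rintro ⟨u, hu⟩
    -- The coboundary of `u` is `v ↦ v u - u v`, the opposite of the inner derivation of `u`.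
    refine ⟨-u, fun v => ?_⟩
    have h : v * u - u * v = f.1 v := LinearMap.congr_fun hu v
    change f.1 v = _
    rw [← h, neg_mul, mul_neg]
    abel
  · rintro ⟨u, hu⟩
    refine ⟨-u, LinearMap.ext fun v => ?_⟩
    have h : f.1 v = u * v - v * u := hu v
    change v * -u - -u * v = f.1 v
    rw [h, neg_mul, mul_neg]
    abel

variable (k A) in
/-- `HH¹` is isomorphic to `Out`, by the identity on representatives. -/
def hh1LieEquivOut : HH1 k A ≃ₗ⁅k⁆ Out k A :=
  quotientLieEquiv (cocycleLieEquiv k A) _ _ mem_hochschildB1_iff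

theorem hh1LieEquivOut_mk (f : hochschildZ1 k A) (d : Der k A) (h : f.1 = d.1) :
    hh1LieEquivOut k A (HH1.mk k A f) = Out.mk k A d := by
  have : cocycleLieEquiv k A f = d := Subtype.ext h
  rw [← this]
  rfl

variable (k A) in
theorem exists_hh1_lieEquiv_out : ∃ e : HH1 k A ≃ₗ⁅k⁆ Out k A,
    ∀ (f : hochschildZ1 k A) (d : Der k A), f.1 = d.1 → e (HH1.mk k A f) = Out.mk k A d :=
  ⟨hh1LieEquivOut k A, hh1LieEquivOut_mk⟩

end Transport

/-! ### Differential operators under a change of coordinates -/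

section ChangeOfCoordinates

variable {k : Type*} [CommRing k] {S S' : Type*} [CommRing S] [Algebra k S] [CommRing S']
  [Algebra k S']

theorem conjAlgEquiv_mulOp (φ : S ≃ₐ[k] S') (s : S) :
    φ.toLinearEquiv.conjAlgEquiv k (mulOp k s) = mulOp k (φ s) := by
  refine LinearMap.ext fun v => ?_
  simp [LinearEquiv.conjAlgEquiv_apply]

theorem IsDiffOp.conj (φ : S ≃ₐ[k] S') : ∀ {n : ℕ} {P : Module.End k S}, IsDiffOp n P →
    IsDiffOp n (φ.toLinearEquiv.conjAlgEquiv k P)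
  | 0, P, h => fun s => by
      have := congrArg (φ.toLinearEquiv.conjAlgEquiv k) (h (φ.symm s))
      rwa [map_sub, map_mul, map_mul, conjAlgEquiv_mulOp, φ.apply_symm_apply, map_zero] at this
  | n + 1, P, h => fun s => by
      have := IsDiffOp.conj φ (h (φ.symm s))
      rwa [map_sub, map_mul, map_mul, conjAlgEquiv_mulOp, φ.apply_symm_apply] at this

theorem conj_mem_diffAlg (φ : S ≃ₐ[k] S') {Q : S} {Q' : S'} (h : Associated (φ Q) Q')
    {P : Module.End k S} (hP : P ∈ DiffAlg k Q) :
    φ.toLinearEquiv.conjAlgEquiv k P ∈ DiffAlg k Q' := by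
  obtain ⟨⟨n, hn⟩, hP'⟩ := hP
  refine ⟨⟨n, hn.conj φ⟩, fun m s hs => ?_⟩
  rw [Ideal.span_singleton_pow, Ideal.mem_span_singleton, ← (h.pow_pow (n := m)).dvd_iff_dvd_left]
    at hs ⊢
  have h1 : Q ^ m ∣ φ.symm s := by
    have := map_dvd φ.symm hs
    rwa [map_pow, φ.symm_apply_apply] at this
  have h2 := hP' m (φ.symm s)
  rw [Ideal.span_singleton_pow, Ideal.mem_span_singleton, Ideal.mem_span_singleton] at h2
  have h3 := map_dvd φ (h2 h1)
  rwa [map_pow] at h3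

/-- A change of coordinates induces an isomorphism of algebras of differential operators. -/
def diffAlgEquiv (φ : S ≃ₐ[k] S') {Q : S} {Q' : S'} (h : Associated (φ Q) Q') :
    DiffAlg k Q ≃ₐ[k] DiffAlg k Q' :=
  ((φ.toLinearEquiv.conjAlgEquiv k).subalgebraMap (DiffAlg k Q)).trans
    (Subalgebra.equivOfEq _ _ (by
      refine le_antisymm ?_ fun P hP => ?_
      · rintro _ ⟨P, hP, rfl⟩
        exact conj_mem_diffAlg φ h hP
      · have h' : Associated (φ.symm Q') Q := by
          have := (h.map φ.symm).symm
          rwa [φ.symm_apply_apply] at this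
        refine ⟨_, conj_mem_diffAlg φ.symm h' hP, ?_⟩
        refine LinearMap.ext fun v => ?_
        simp [LinearEquiv.conjAlgEquiv_apply]))

end ChangeOfCoordinates

/-! ### Normal form of three lines -/

section Linear

open MvPolynomial

variable {k : Type*} [Field k]

/-- An invertible matrix defines a linear change of coordinates. -/
theorem exists_algEquiv_of_det_ne_zero {p q r s : k} (h : p * s - q * r ≠ 0) :
    ∃ φ : MvPolynomial (Fin 2) k ≃ₐ[k] MvPolynomial (Fin 2) k,
      φ (X 0) = p • X 0 + q • X 1 ∧ φ (X 1) = r • X 0 + s • X 1 := by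
  set D := p * s - q * r with hD
  refine ⟨AlgEquiv.ofAlgHom (aeval ![p • X 0 + q • X 1, r • X 0 + s • X 1])
    (aeval ![(s / D) • X 0 + (-q / D) • X 1, (-r / D) • X 0 + (p / D) • X 1]) ?_ ?_, ?_, ?_⟩
  · ext i : 1
    fin_cases i
    · simp only [AlgHom.comp_apply, aeval_X, Fin.zero_eta, Matrix.cons_val_zero, map_add, map_smul,
        Matrix.cons_val_one, AlgHom.id_apply, smul_add, smul_smul]
      match_scalars <;> field_simp <;> rw [hD] <;> ring
    · simp only [AlgHom.comp_apply, aeval_X, Fin.mk_one, Matrix.cons_val_zero, map_add, map_smul,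
        Matrix.cons_val_one, AlgHom.id_apply, smul_add, smul_smul]
      match_scalars <;> field_simp <;> rw [hD] <;> ring
  · ext i : 1
    fin_cases i
    · simp only [AlgHom.comp_apply, aeval_X, Fin.zero_eta, Matrix.cons_val_zero, map_add, map_smul,
        Matrix.cons_val_one, AlgHom.id_apply, smul_add, smul_smul]
      match_scalars <;> field_simp <;> rw [hD] <;> ring
    · simp only [AlgHom.comp_apply, aeval_X, Fin.mk_one, Matrix.cons_val_zero, map_add, map_smul,
        Matrix.cons_val_one, AlgHom.id_apply, smul_add, smul_smul]
      match_scalars <;> field_simp <;> rw [hD] <;> ring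
  · simp
  · simp

theorem det_ne_zero_of_linearIndependent {a b a' b' : k}
    (h : LinearIndependent k ![(a • X 0 + b • X 1 : MvPolynomial (Fin 2) k), a' • X 0 + b' • X 1]) :
    a * b' - b * a' ≠ 0 := by
  intro h0
  rw [LinearIndependent.pair_iff] at h
  have h1 := h b' (-b) (by
    have : b' • (a • X 0 + b • X 1) + (-b) • (a' • X 0 + b' • X 1) =
      (a * b' - b * a') • (X 0 : MvPolynomial (Fin 2) k) := by module
    rw [this, h0, zero_smul])
  have h2 := h (-a') a (by
    have : (-a') • (a • X 0 + b • X 1) + a • (a' • X 0 + b' • X 1) =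
      (a * b' - b * a') • (X 1 : MvPolynomial (Fin 2) k) := by module
    rw [this, h0, zero_smul])
  have ha : a = 0 := h2.2
  have hb : b = 0 := neg_eq_zero.1 h1.2
  exact one_ne_zero (h 1 0 (by simp [ha, hb])).1

/-- Every central arrangement of three lines is `x y (x + y) = 0` in suitable coordinates. -/
theorem exists_algEquiv_associated (ℓ : Fin 3 → MvPolynomial (Fin 2) k)
    (hℓ : ∀ i, (ℓ i).IsHomogeneous 1)
    (hind : ∀ i j, i ≠ j → LinearIndependent k ![ℓ i, ℓ j]) :
    ∃ φ : MvPolynomial (Fin 2) k ≃ₐ[k] MvPolynomial (Fin 2) k,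
      Associated (φ (polyQ (1 : k))) (∏ i, ℓ i) := by
  choose a b hab using fun i => exists_eq_of_isHomogeneous_one (hℓ i)
  have hdet : ∀ i j, i ≠ j → a i * b j - b i * a j ≠ 0 := fun i j hij => by
    have := hind i j hij
    rw [hab i, hab j] at this
    exact det_ne_zero_of_linearIndependent this
  set Δ := a 0 * b 1 - b 0 * a 1 with hΔ
  have hΔ0 : Δ ≠ 0 := hdet 0 1 (by decide)
  -- By Cramer's rule `ℓ₂ = α ℓ₀ + β ℓ₁`. The substitution `x ↦ α ℓ₀`, `y ↦ β ℓ₁` then sends `x + y`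
  -- to `ℓ₂`, and the product of the three forms changes only by the unit `α β`.
  set α := (a 2 * b 1 - b 2 * a 1) / Δ with hα
  set β := (a 0 * b 2 - b 0 * a 2) / Δ with hβ
  have hα0 : α ≠ 0 := div_ne_zero (hdet 2 1 (by decide)) hΔ0
  have hβ0 : β ≠ 0 := div_ne_zero (hdet 0 2 (by decide)) hΔ0
  have e1 : a 2 = α * a 0 + β * a 1 := by
    rw [hα, hβ]; field_simp; rw [hΔ]; ring
  have e2 : b 2 = α * b 0 + β * b 1 := by
    rw [hα, hβ]; field_simp; rw [hΔ]; ring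
  obtain ⟨φ, h0, h1⟩ := exists_algEquiv_of_det_ne_zero (p := α * a 0) (q := α * b 0)
    (r := β * a 1) (s := β * b 1) (by
      have : α * a 0 * (β * b 1) - α * b 0 * (β * a 1) = α * β * Δ := by rw [hΔ]; ring
      rw [this]
      exact mul_ne_zero (mul_ne_zero hα0 hβ0) hΔ0)
  refine ⟨φ, (Associated.of_eq ?_).trans
    (associated_unit_mul_left (∏ i, ℓ i) (C (α * β)) ((mul_ne_zero hα0 hβ0).isUnit.map C))⟩
  rw [polyQ, polyF, Fin.prod_univ_three, map_one, one_mul, map_mul, map_mul, map_add, h0, h1,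
    hab 0, hab 1, hab 2, e1, e2]
  simp only [smul_eq_C_mul, map_mul, map_add]
  ring

set_option maxHeartbeats 1000000 in
theorem isLieAbelian_out_diffAlg_and_finrank [CharZero k] (ℓ : Fin 3 → MvPolynomial (Fin 2) k)
    (hℓ : ∀ i, (ℓ i).IsHomogeneous 1)
    (hind : ∀ i j, i ≠ j → LinearIndependent k ![ℓ i, ℓ j]) :
    IsLieAbelian (Out k (DiffAlg k (∏ i, ℓ i))) ∧
      Module.finrank k (Out k (DiffAlg k (∏ i, ℓ i))) = 3 := by
  obtain ⟨φ, hφ⟩ := exists_algEquiv_associated ℓ hℓ hind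
  have h : IsLieAbelian (Out k (U (1 : k))) ∧ Module.finrank k (Out k (U (1 : k))) = 3 :=
    isLieAbelian_out_and_finrank one_ne_zero
  exact isLieAbelian_out_and_finrank_of_algEquiv (diffAlgEquiv φ hφ) h

theorem linearIndependent_mk_and_span_mk [CharZero k] {t : k} (ht : t ≠ 0)
    {d : Fin 3 → Der k (U t)} (hd : ∀ i, IsPartial t (form t i) (d i)) :
    LinearIndependent k (fun i => Out.mk k (U t) (d i)) ∧
      Submodule.span k (Set.range fun i => Out.mk k (U t) (d i)) = ⊤ :=
  ⟨linearIndependent_mk ht hd, span_mk ht hd⟩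

end Linear

end ThreeLines

end

theorem mainTheorem4 (k : Type*) [Field k] [CharZero k] :
    -- for every central arrangement of three (distinct) lines in the plane, with defining
    -- polynomial `ℓ₀ ℓ₁ ℓ₂`: `HH¹ = Out` is an abelian Lie algebra of dimension three
    (∀ ℓ : Fin 3 → MvPolynomial (Fin 2) k, (∀ i, (ℓ i).IsHomogeneous 1) →
      (∀ i j, i ≠ j → LinearIndependent k ![ℓ i, ℓ j]) →
      (∃ e : ThreeLines.HH1 k (ThreeLines.DiffAlg k (∏ i, ℓ i)) ≃ₗ⁅k⁆
            ThreeLines.Out k (ThreeLines.DiffAlg k (∏ i, ℓ i)),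
          ∀ (f : ThreeLines.hochschildZ1 k (ThreeLines.DiffAlg k (∏ i, ℓ i)))
            (d : ThreeLines.Der k (ThreeLines.DiffAlg k (∏ i, ℓ i))), f.1 = d.1 →
            e (ThreeLines.HH1.mk k _ f) = ThreeLines.Out.mk k _ d) ∧
        IsLieAbelian (ThreeLines.Out k (ThreeLines.DiffAlg k (∏ i, ℓ i))) ∧
        Module.finrank k (ThreeLines.Out k (ThreeLines.DiffAlg k (∏ i, ℓ i))) = 3) ∧
    -- in coordinates with defining polynomial `x y (t x + y)`: the derivations `∂_f` exist, are
    -- uniquely determined, and their classes form a basis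
    (∀ t : k, t ≠ 0 →
      (∀ i, ∃! d : ThreeLines.Der k (ThreeLines.U t),
        ThreeLines.IsPartial t (ThreeLines.form t i) d) ∧
      ∀ d : Fin 3 → ThreeLines.Der k (ThreeLines.U t),
        (∀ i, ThreeLines.IsPartial t (ThreeLines.form t i) (d i)) →
        LinearIndependent k (fun i => ThreeLines.Out.mk k (ThreeLines.U t) (d i)) ∧
        Submodule.span k (Set.range fun i => ThreeLines.Out.mk k (ThreeLines.U t) (d i)) = ⊤) := by
  refine ⟨fun ℓ hℓ hind => ?_, fun t ht => ⟨ThreeLines.existsUnique_isPartial ht, fun d hd =>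
    ThreeLines.linearIndependent_mk_and_span_mk ht hd⟩⟩
  exact ⟨ThreeLines.exists_hh1_lieEquiv_out k _,
    ThreeLines.isLieAbelian_out_diffAlg_and_finrank ℓ hℓ hind⟩
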